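/- Let $\mathbb S^2\subset\mathbb R^3$ be the unit sphere and let $\gamma:\mathbb S^1\to\mathbb S^2$ be a smooth, regular, simple closed curve that is strictly convex: $\gamma=\partial\Omega$ is the positively oriented boundary of a domain $\Omega\subset\mathbb S^2$ (the enclosed disc), and its geodesic curvature is everywhere positive, $k_g>0$. Here $s$ is arclength, $t=\gamma_s$, positive orientation means that the unit normal $\eta=\gamma\times t$ points into $\Omega$, and $k_g=\langle t_s,\eta\rangle$. Let $L$ be the length of $\gamma$, $A$ the area of $\Omega$, $\|k_g\|_\infty=\sup_\gamma|k_g|$, and $$\bar k_g:=\frac1L\int_\gamma k_g\,ds .$$ Then $$L^{2}-A(4\pi-A)\le\left(\int_{\gamma}\sqrt{1+k_g^{2}}\,ds\right)^{2}-4\pi^{2}-\frac{L}{1+\|k_g\|_\infty^{2}}\int_\gamma (k_g-\bar k_g)^2\,ds .$$ Equality holds if and only if $\gamma$ is a geodesic circle, that is, its image is $\{x\in\mathbb S^2: d(x,p)=r\}$ for some $p\in\mathbb S^2$ and $r\in(0,\pi)$, where $d$ is the geodesic distance. -/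

import Mathlib

open scoped ContDiff Topology

noncomputable section

namespace SphericalCurve

/-- Euclidean three-space. -/
abbrev E3 : Type := EuclideanSpace ℝ (Fin 3)

/-- The unit sphere in Euclidean three-space, as a type. -/
abbrev S2 : Type := Metric.sphere (0 : E3) 1

/-- The cross product on Euclidean three-space. -/
def cross (v w : E3) : E3 :=
  WithLp.toLp 2 (crossProduct (WithLp.ofLp v) (WithLp.ofLp w))

/-- A smooth, regular, simple closed curve on the unit sphere. Maps of the circle `ℝ / 2πℤ` are
represented by `2π`-periodic maps of `ℝ`. -/
structure IsSmoothSimpleClosed (γ : ℝ → E3) : Prop where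
  smooth : ContDiff ℝ ∞ γ
  periodic : Function.Periodic γ (2 * Real.pi)
  mem_sphere : ∀ u, γ u ∈ Metric.sphere (0 : E3) 1
  regular : ∀ u, deriv γ u ≠ 0
  simple : Set.InjOn γ (Set.Ico 0 (2 * Real.pi))

/-- The speed `ds/du`. -/
def speed (γ : ℝ → E3) (u : ℝ) : ℝ := ‖deriv γ u‖

/-- The unit tangent `t = γ_s`. -/
def tangent (γ : ℝ → E3) (u : ℝ) : E3 := (speed γ u)⁻¹ • deriv γ u

/-- The unit normal `η = γ × t` of the curve in the sphere; it points to the left of `γ`. -/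
def normal (γ : ℝ → E3) (u : ℝ) : E3 := cross (γ u) (tangent γ u)

/-- The geodesic curvature `k_g = ⟨t_s, η⟩`, where `∂_s = |γ_u|⁻¹ ∂_u`. -/
def geodesicCurvature (γ : ℝ → E3) (u : ℝ) : ℝ :=
  inner ℝ ((speed γ u)⁻¹ • deriv (tangent γ) u) (normal γ u)

/-- The integral `∫_γ f ds` with respect to arclength. -/
def arcIntegral (γ : ℝ → E3) (f : ℝ → ℝ) : ℝ :=
  ∫ u in (0 : ℝ)..(2 * Real.pi), f u * speed γ u

/-- The length of `γ`. -/
def length (γ : ℝ → E3) : ℝ := arcIntegral γ fun _ => 1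

/-- The mean of the geodesic curvature along `γ`. -/
def meanCurvature (γ : ℝ → E3) : ℝ := (length γ)⁻¹ * arcIntegral γ (geodesicCurvature γ)

/-- The sup norm of the geodesic curvature. -/
def supCurvature (γ : ℝ → E3) : ℝ := ⨆ u, |geodesicCurvature γ u|

/-- `Ω` is the region of the sphere enclosed by `γ`, and `γ` is its positively oriented boundary:
`Ω` is a domain with boundary `γ`, and `η` is the normal of `γ` that points into `Ω` (the geodesic
issuing from `γ u` in direction `η u` enters `Ω`, the one in direction `-η u` stays outside). -/
structure IsEnclosedRegion (γ : ℝ → E3) (Ω : Set S2) : Prop where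
  isOpen : IsOpen Ω
  isConnected : IsConnected Ω
  frontier_eq : frontier Ω = {x : S2 | (x : E3) ∈ Set.range γ}
  inward : ∀ u, ∀ᶠ ε in 𝓝[>] (0 : ℝ),
    Real.cos ε • γ u + Real.sin ε • normal γ u ∈ Subtype.val '' Ω
  outward : ∀ u, ∀ᶠ ε in 𝓝[>] (0 : ℝ),
    Real.cos ε • γ u - Real.sin ε • normal γ u ∉ Subtype.val '' Ω

/-- The area of a region of the unit sphere; the total area of the sphere is `4π`. -/
def area (Ω : Set S2) : ℝ :=
  ((MeasureTheory.volume : MeasureTheory.Measure E3).toSphere Ω).toReal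

/-- The trace of `γ` is a geodesic circle: the set of points of the sphere at a fixed geodesic
distance `r ∈ (0, π)` from a point `p` of the sphere. -/
def IsGeodesicCircle (γ : ℝ → E3) : Prop :=
  ∃ p ∈ Metric.sphere (0 : E3) 1, ∃ r ∈ Set.Ioo 0 Real.pi,
    Set.range γ = {x | x ∈ Metric.sphere (0 : E3) 1 ∧ InnerProductGeometry.angle p x = r}

end SphericalCurve

end

noncomputable section

namespace SphericalCurve

local notation "⟪" x ", " y "⟫" => inner ℝ x y

/-! ### The cross product and orthonormal frames -/

/-! Write `K` for the total geodesic curvature and `S` for the integral of `√(1 + k_g²)`.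
Gauss–Bonnet gives `A = 2π - K`, so `A(4π - A) = 4π² - K²`, and the claim becomes `S² - L² - K² -
L/(1 + M²) ∫ (k_g - k̄_g)² ds ≥ 0` with `M` the sup norm. The left side is the double integral over
`γ × γ` of `deficit M (k u) (k v)` (`integral_integral_deficit`). Since `(1 + x²)(1 + y²) - (1 +
xy)² = (x - y)²`, this integrand is nonnegative for `0 < x, y ≤ M`, and positive unless `x = y`.
Equality therefore means that `k_g` is constant, which for these curves characterizes geodesic
circles.

Gauss–Bonnet (`area_eq_two_pi_sub`) is obtained by computing volumes in the unit ball. Up to a null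
set, the ball is the disjoint union of the cone over `Ω`, its antipode, and the half-disks spanned
by `±γ u` and `t u`. The two cones have volume `A/3` each. The Jacobian of the half-disk
parametrization gives the rest volume `2K/3`, provided that the half-disks cover it exactly once.

That covering property rests on convexity of the cone (`convex_cone`). Positive curvature makes the
cone strictly convex near each boundary ray, so a segment in the closed cone can touch the boundary
only radially. A connectedness argument then makes every point of the cone visible from every other.
Convexity supplies global supporting planes, which yield injectivity; a sign-change argument for
`⟨x, η⟩` yields surjectivity. -/

lemma inner_eq_sum (x y : E3) : ⟪x, y⟫ = x 0 * y 0 + x 1 * y 1 + x 2 * y 2 := by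
  simp [PiLp.inner_apply, Fin.sum_univ_three]
  ring

@[simp] lemma cross_zero_apply (v w : E3) : cross v w 0 = v 1 * w 2 - v 2 * w 1 := by
  simp [cross, cross_apply]

@[simp] lemma cross_one_apply (v w : E3) : cross v w 1 = v 2 * w 0 - v 0 * w 2 := by
  simp [cross, cross_apply]

@[simp] lemma cross_two_apply (v w : E3) : cross v w 2 = v 0 * w 1 - v 1 * w 0 := by
  simp [cross, cross_apply]

lemma ext_coord {v w : E3} (h0 : v 0 = w 0) (h1 : v 1 = w 1) (h2 : v 2 = w 2) : v = w := by
  ext i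
  fin_cases i
  exacts [h0, h1, h2]

/-- The cross product as a continuous bilinear map. -/
def crossL : E3 →L[ℝ] E3 →L[ℝ] E3 :=
  LinearMap.toContinuousBilinearMap <| LinearMap.mk₂ ℝ cross
    (fun _ _ _ => by apply ext_coord <;> simp <;> ring)
    (fun _ _ _ => by apply ext_coord <;> simp <;> ring)
    (fun _ _ _ => by apply ext_coord <;> simp <;> ring)
    (fun _ _ _ => by apply ext_coord <;> simp <;> ring)

@[simp] lemma crossL_apply (v w : E3) : crossL v w = cross v w := rfl

lemma inner_cross_self_left (a b : E3) : ⟪a, cross a b⟫ = 0 := by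
  simp [inner_eq_sum]; ring

lemma inner_cross_self_right (a b : E3) : ⟪b, cross a b⟫ = 0 := by
  simp [inner_eq_sum]; ring

lemma inner_cross_swap (a b c : E3) : ⟪c, cross a b⟫ = -⟪a, cross c b⟫ := by
  simp [inner_eq_sum]; ring

lemma inner_cross_cross (a b c d : E3) :
    ⟪cross a b, cross c d⟫ = ⟪a, c⟫ * ⟪b, d⟫ - ⟪a, d⟫ * ⟪b, c⟫ := by
  simp [inner_eq_sum]; ring

lemma cross_self_eq_zero (a : E3) : cross a a = 0 := by
  apply ext_coord <;> simp <;> ring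

lemma cross_cross_left (a b : E3) : cross a (cross a b) = ⟪a, b⟫ • a - ⟪a, a⟫ • b := by
  simp only [inner_eq_sum]
  apply ext_coord <;> simp <;> ring

lemma inner_cross_self_of_orthonormal {a b : E3} (ha : ⟪a, a⟫ = 1) (hb : ⟪b, b⟫ = 1)
    (hab : ⟪a, b⟫ = 0) : ⟪cross a b, cross a b⟫ = 1 := by
  rw [inner_cross_cross, ha, hb, hab]; ring

lemma frame_expansion {a b : E3} (ha : ⟪a, a⟫ = 1) (hb : ⟪b, b⟫ = 1) (hab : ⟪a, b⟫ = 0) (x : E3) :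
    x = ⟪x, a⟫ • a + ⟪x, b⟫ • b + ⟪x, cross a b⟫ • cross a b := by
  have ho : Orthonormal ℝ ![a, b, cross a b] := by
    have hn : ∀ v : E3, ⟪v, v⟫ = 1 → ‖v‖ = 1 := fun v hv => by
      rw [real_inner_self_eq_norm_sq] at hv
      nlinarith [norm_nonneg v]
    refine ⟨fun i => ?_, fun i j hij => ?_⟩
    · fin_cases i
      exacts [hn _ ha, hn _ hb, hn _ (inner_cross_self_of_orthonormal ha hb hab)]
    · have h1 := inner_cross_self_left a b
      have h2 := inner_cross_self_right a b
      fin_cases i <;> fin_cases j <;>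
        simp_all [real_inner_comm a b, real_inner_comm _ (cross a b)]
  have hs : ⊤ ≤ Submodule.span ℝ (Set.range ![a, b, cross a b]) := by
    rw [ho.linearIndependent.span_eq_top_of_card_eq_finrank (by simp)]
  have h := (OrthonormalBasis.mk ho hs).sum_repr' x
  rw [Fin.sum_univ_three] at h
  simp only [OrthonormalBasis.coe_mk, Matrix.cons_val_zero, Matrix.cons_val_one,
    Matrix.cons_val_two] at h
  rw [real_inner_comm a x, real_inner_comm b x, real_inner_comm (cross a b) x]
  exact h.symm

lemma eq_smul_of_orthogonal {a b x : E3} (ha : ⟪a, a⟫ = 1) (hb : ⟪b, b⟫ = 1) (hab : ⟪a, b⟫ = 0)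
    (h1 : ⟪x, b⟫ = 0) (h2 : ⟪x, cross a b⟫ = 0) : x = ⟪x, a⟫ • a := by
  conv_lhs => rw [frame_expansion ha hb hab x, h1, h2]
  simp

lemma inner_self_expansion {a b : E3} (ha : ⟪a, a⟫ = 1) (hb : ⟪b, b⟫ = 1) (hab : ⟪a, b⟫ = 0)
    (x : E3) : ⟪x, x⟫ = ⟪x, a⟫ ^ 2 + ⟪x, b⟫ ^ 2 + ⟪x, cross a b⟫ ^ 2 := by
  conv_lhs => rw [frame_expansion ha hb hab x]
  simp only [inner_add_left, inner_add_right, inner_smul_left, inner_smul_right, ha, hb, hab,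
    real_inner_comm a b, inner_cross_self_left, inner_cross_self_right,
    real_inner_comm a (cross a b), real_inner_comm b (cross a b),
    inner_cross_self_of_orthonormal ha hb hab]
  simp only [conj_trivial, mul_one, mul_zero, add_zero, zero_add]
  ring

/-- The determinant of an endomorphism of Euclidean three-space as a triple product. -/
lemma det_eq_triple_product (T : E3 →L[ℝ] E3) :
    T.det = ⟪T (EuclideanSpace.single 0 1),
      cross (T (EuclideanSpace.single 1 1)) (T (EuclideanSpace.single 2 1))⟫ := by
  rw [ContinuousLinearMap.det,
    ← LinearMap.det_toMatrix (EuclideanSpace.basisFun (Fin 3) ℝ).toBasis, Matrix.det_fin_three]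
  simp [LinearMap.toMatrix_apply, inner_eq_sum]
  ring

/-! ### The Frenet frame -/

lemma inner_normal (γ : ℝ → E3) (u : ℝ) : ⟪γ u, normal γ u⟫ = 0 := inner_cross_self_left _ _

lemma inner_tangent_normal (γ : ℝ → E3) (u : ℝ) : ⟪tangent γ u, normal γ u⟫ = 0 :=
  inner_cross_self_right _ _

lemma _root_.Function.Periodic.deriv {f : ℝ → E3} {c : ℝ} (hf : Function.Periodic f c) :
    Function.Periodic (deriv f) c := fun u => by
  rw [← deriv_comp_add_const f c u, funext hf]

namespace IsSmoothSimpleClosed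

variable {γ : ℝ → E3} (hγ : IsSmoothSimpleClosed γ)
include hγ


lemma inner_self (u : ℝ) : ⟪γ u, γ u⟫ = 1 := by
  have h := hγ.mem_sphere u
  rw [mem_sphere_zero_iff_norm] at h
  rw [real_inner_self_eq_norm_sq, h, one_pow]

lemma speed_pos (u : ℝ) : 0 < speed γ u := norm_pos_iff.2 (hγ.regular u)

lemma contDiff_deriv : ContDiff ℝ ∞ (deriv γ) :=
  (contDiff_infty_iff_deriv.1 hγ.smooth).2

lemma contDiff_speed : ContDiff ℝ ∞ (speed γ) :=
  hγ.contDiff_deriv.norm ℝ hγ.regular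

lemma contDiff_tangent : ContDiff ℝ ∞ (tangent γ) :=
  (hγ.contDiff_speed.inv fun u => (hγ.speed_pos u).ne').smul hγ.contDiff_deriv

lemma contDiff_normal : ContDiff ℝ ∞ (normal γ) :=
  (crossL.isBoundedBilinearMap.contDiff.comp (hγ.smooth.prodMk hγ.contDiff_tangent))

lemma continuous : Continuous γ := hγ.smooth.continuous

lemma continuous_speed : Continuous (speed γ) := hγ.contDiff_speed.continuous

lemma continuous_normal : Continuous (normal γ) := hγ.contDiff_normal.continuous

lemma continuous_geodesicCurvature : Continuous (geodesicCurvature γ) := by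
  have h : Continuous (deriv (tangent γ)) :=
    (contDiff_infty_iff_deriv.1 hγ.contDiff_tangent).2.continuous
  exact ((hγ.continuous_speed.inv₀ fun u => (hγ.speed_pos u).ne').smul h).inner hγ.continuous_normal

lemma deriv_eq (u : ℝ) : deriv γ u = speed γ u • tangent γ u := by
  rw [tangent, smul_smul, mul_inv_cancel₀ (hγ.speed_pos u).ne', one_smul]

lemma hasDerivAt (u : ℝ) : HasDerivAt γ (speed γ u • tangent γ u) u := by
  rw [← hγ.deriv_eq]
  exact (hγ.smooth.differentiable (by simp) u).hasDerivAt

lemma inner_tangent_self (u : ℝ) : ⟪tangent γ u, tangent γ u⟫ = 1 := by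
  rw [tangent, inner_smul_left, inner_smul_right, real_inner_self_eq_norm_sq]
  have := (hγ.speed_pos u).ne'
  simp only [conj_trivial]
  rw [← speed]
  field_simp

lemma inner_tangent (u : ℝ) : ⟪γ u, tangent γ u⟫ = 0 := by
  have h := (hγ.hasDerivAt u).inner ℝ (hγ.hasDerivAt u)
  have h2 : HasDerivAt (fun u => ⟪γ u, γ u⟫) 0 u := by
    simp only [hγ.inner_self]
    exact hasDerivAt_const u 1
  have h3 := h.unique h2
  rw [inner_smul_left, inner_smul_right, real_inner_comm (γ u)] at h3
  have := hγ.speed_pos u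
  simp only [conj_trivial] at h3
  have h4 : speed γ u * ⟪γ u, tangent γ u⟫ = 0 := by linarith
  exact (mul_eq_zero.1 h4).resolve_left this.ne'

lemma inner_normal_self (u : ℝ) : ⟪normal γ u, normal γ u⟫ = 1 :=
  inner_cross_self_of_orthonormal (hγ.inner_self u) (hγ.inner_tangent_self u) (hγ.inner_tangent u)

lemma expansion (u : ℝ) (x : E3) :
    x = ⟪x, γ u⟫ • γ u + ⟪x, tangent γ u⟫ • tangent γ u + ⟪x, normal γ u⟫ • normal γ u :=
  frame_expansion (hγ.inner_self u) (hγ.inner_tangent_self u) (hγ.inner_tangent u) x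

lemma deriv_tangent (u : ℝ) : deriv (tangent γ) u =
    speed γ u • (-γ u + geodesicCurvature γ u • normal γ u) := by
  have ht : HasDerivAt (tangent γ) (deriv (tangent γ) u) u :=
    (hγ.contDiff_tangent.differentiable (by simp) u).hasDerivAt
  have h1 : ⟪deriv (tangent γ) u, tangent γ u⟫ = 0 := by
    have h := ht.inner ℝ ht
    have h2 : HasDerivAt (fun u => ⟪tangent γ u, tangent γ u⟫) 0 u := by
      simp only [hγ.inner_tangent_self]
      exact hasDerivAt_const u 1
    have h3 := h.unique h2
    rw [real_inner_comm (tangent γ u)] at h3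
    rw [real_inner_comm]
    linarith
  have h2 : ⟪deriv (tangent γ) u, γ u⟫ = -speed γ u := by
    have h := (hγ.hasDerivAt u).inner ℝ ht
    have h2 : HasDerivAt (fun u => ⟪γ u, tangent γ u⟫) 0 u := by
      simp only [hγ.inner_tangent]
      exact hasDerivAt_const u 0
    have h3 := h.unique h2
    rw [inner_smul_left, hγ.inner_tangent_self] at h3
    simp only [conj_trivial] at h3
    rw [real_inner_comm]
    linarith
  have h3 : ⟪deriv (tangent γ) u, normal γ u⟫ = speed γ u * geodesicCurvature γ u := by
    have := (hγ.speed_pos u).ne'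
    rw [geodesicCurvature, inner_smul_left]
    simp only [conj_trivial]
    field_simp
  rw [hγ.expansion u (deriv (tangent γ) u), h1, h2, h3]
  module

lemma hasDerivAt_tangent (u : ℝ) : HasDerivAt (tangent γ)
    (speed γ u • (-γ u + geodesicCurvature γ u • normal γ u)) u := by
  rw [← hγ.deriv_tangent]
  exact (hγ.contDiff_tangent.differentiable (by simp) u).hasDerivAt

lemma cross_normal (u : ℝ) : cross (γ u) (normal γ u) = -tangent γ u := by
  rw [normal, cross_cross_left, hγ.inner_tangent, hγ.inner_self]
  simp

/-- Since `η_s = -k_g t` and `k_g > 0`, the height `⟨x, η⟩` of a fixed `x` is critical exactly where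
`⟨x, t⟩ = 0`; the covering argument uses this. -/
lemma hasDerivAt_normal (u : ℝ) : HasDerivAt (normal γ)
    (-(speed γ u * geodesicCurvature γ u) • tangent γ u) u := by
  have h := ContinuousLinearMap.hasDerivAt_of_bilinear (B := crossL)
    (fun _ => hγ.hasDerivAt u) (fun _ => hγ.hasDerivAt_tangent u)
  have e : crossL (γ u) (speed γ u • (-γ u + geodesicCurvature γ u • normal γ u)) +
      crossL (speed γ u • tangent γ u) (tangent γ u) =
      -(speed γ u * geodesicCurvature γ u) • tangent γ u := by
    rw [map_smul, map_add, map_neg, map_smul, map_smul]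
    simp only [crossL_apply, _root_.smul_apply, cross_self_eq_zero, hγ.cross_normal]
    module
  rw [← e]
  exact h

lemma periodic_deriv : Function.Periodic (deriv γ) (2 * Real.pi) := hγ.periodic.deriv

lemma periodic_speed : Function.Periodic (speed γ) (2 * Real.pi) := fun u => by
  rw [speed, hγ.periodic_deriv u, speed]

lemma periodic_tangent : Function.Periodic (tangent γ) (2 * Real.pi) := fun u => by
  rw [tangent, hγ.periodic_speed u, hγ.periodic_deriv u, tangent]

lemma periodic_normal : Function.Periodic (normal γ) (2 * Real.pi) := fun u => by
  rw [normal, hγ.periodic u, hγ.periodic_tangent u, normal]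

lemma periodic_geodesicCurvature : Function.Periodic (geodesicCurvature γ) (2 * Real.pi) :=
  fun u => by
    rw [geodesicCurvature, hγ.periodic_speed u, hγ.periodic_normal u,
      hγ.periodic_tangent.deriv u, geodesicCurvature]

end IsSmoothSimpleClosed

/-! ### The analytic inequality -/

/-- The integrand of the deficit, as a function of two curvature values bounded by `M`. -/
def deficit (M x y : ℝ) : ℝ :=
  √(1 + x ^ 2) * √(1 + y ^ 2) - 1 - x * y - (x - y) ^ 2 / (2 * (1 + M ^ 2))

/-- Rationalize: with `P = √(1 + x²)√(1 + y²)` and `Q = 1 + xy`, `P² - Q² = (x - y)²`, so `P - Q =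
(x - y)²/(P + Q)`. The sign is then that of `2(1 + M²) - (P + Q)`. -/
lemma deficit_eq {M x y : ℝ} (hx : 0 < x) (hy : 0 < y) :
    deficit M x y = (x - y) ^ 2 * (2 * (1 + M ^ 2) - (√(1 + x ^ 2) * √(1 + y ^ 2) + 1 + x * y)) /
      ((√(1 + x ^ 2) * √(1 + y ^ 2) + 1 + x * y) * (2 * (1 + M ^ 2))) := by
  have h1 : √(1 + x ^ 2) ^ 2 = 1 + x ^ 2 := Real.sq_sqrt (by positivity)
  have h2 : √(1 + y ^ 2) ^ 2 = 1 + y ^ 2 := Real.sq_sqrt (by positivity)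
  have h3 : 0 < √(1 + x ^ 2) * √(1 + y ^ 2) + 1 + x * y := by positivity
  have h4 : 0 < 2 * (1 + M ^ 2) := by positivity
  have h5 : (√(1 + x ^ 2) * √(1 + y ^ 2)) ^ 2 = (1 + x ^ 2) * (1 + y ^ 2) := by
    rw [mul_pow, h1, h2]
  rw [deficit, eq_div_iff (by positivity), sub_mul, div_mul_eq_mul_div,
    mul_comm _ (2 * (1 + M ^ 2)), mul_left_comm ((x - y) ^ 2), mul_div_cancel_left₀ _ h4.ne']
  linear_combination (2 * (1 + M ^ 2)) * h5

lemma sqrt_mul_sqrt_le {M x y : ℝ} (hx : 0 < x) (hy : 0 < y) (hxM : x ≤ M) (hyM : y ≤ M) :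
    √(1 + x ^ 2) * √(1 + y ^ 2) ≤ 1 + M ^ 2 := by
  rw [← Real.sqrt_mul (by positivity)]
  apply Real.sqrt_le_iff.2 ⟨by positivity, ?_⟩
  rw [sq (1 + M ^ 2)]
  gcongr

lemma deficit_nonneg {M x y : ℝ} (hx : 0 < x) (hy : 0 < y) (hxM : x ≤ M) (hyM : y ≤ M) :
    0 ≤ deficit M x y := by
  rw [deficit_eq hx hy]
  have h1 := sqrt_mul_sqrt_le hx hy hxM hyM
  have h2 : x * y ≤ M ^ 2 := by rw [sq]; gcongr; linarith
  apply div_nonneg (mul_nonneg (sq_nonneg _) (by linarith)) (by positivity)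

lemma deficit_pos {M x y : ℝ} (hx : 0 < x) (hy : 0 < y) (hxM : x ≤ M) (hyM : y ≤ M)
    (hxy : x ≠ y) : 0 < deficit M x y := by
  rw [deficit_eq hx hy]
  have h1 := sqrt_mul_sqrt_le hx hy hxM hyM
  have h2 : x * y < M ^ 2 := by
    rcases lt_or_gt_of_ne hxy with h | h
    · nlinarith
    · nlinarith
  have h3 : x - y ≠ 0 := sub_ne_zero.2 hxy
  apply div_pos (mul_pos (by positivity) (by linarith)) (by positivity)

section

variable {a b M : ℝ} {w k : ℝ → ℝ}

/-- The closed form in `y` serves both for the second integration and for continuity of the inner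
integral. -/
lemma integral_deficit (hw : Continuous w) (hk : Continuous k) (y : ℝ) :
    ∫ u in a..b, deficit M (k u) y * w u =
      √(1 + y ^ 2) * (∫ u in a..b, √(1 + k u ^ 2) * w u) - (∫ u in a..b, w u)
        - y * (∫ u in a..b, k u * w u)
        - (2 * (1 + M ^ 2))⁻¹ * ((∫ u in a..b, k u ^ 2 * w u) - 2 * y * (∫ u in a..b, k u * w u)
          + y ^ 2 * ∫ u in a..b, w u) := by
  have i1 : IntervalIntegrable (fun u => √(1 + k u ^ 2) * w u) MeasureTheory.volume a b :=
    Continuous.intervalIntegrable (by fun_prop) a b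
  have i2 : IntervalIntegrable (fun u => w u) MeasureTheory.volume a b :=
    Continuous.intervalIntegrable (by fun_prop) a b
  have i3 : IntervalIntegrable (fun u => k u * w u) MeasureTheory.volume a b :=
    Continuous.intervalIntegrable (by fun_prop) a b
  have i4 : IntervalIntegrable (fun u => k u ^ 2 * w u) MeasureTheory.volume a b :=
    Continuous.intervalIntegrable (by fun_prop) a b
  have e : ∀ u, deficit M (k u) y * w u = √(1 + y ^ 2) * (√(1 + k u ^ 2) * w u) - w u
      - y * (k u * w u)
      - (2 * (1 + M ^ 2))⁻¹ * (k u ^ 2 * w u - 2 * y * (k u * w u) + y ^ 2 * w u) :=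
    fun u => by rw [deficit, div_eq_inv_mul]; ring
  simp only [e]
  rw [intervalIntegral.integral_sub (((i1.const_mul _).sub i2).sub (i3.const_mul _))
      (((i4.sub (i3.const_mul _)).add (i2.const_mul _)).const_mul _),
    intervalIntegral.integral_sub ((i1.const_mul _).sub i2) (i3.const_mul _),
    intervalIntegral.integral_sub (i1.const_mul _) i2, intervalIntegral.integral_const_mul,
    intervalIntegral.integral_const_mul, intervalIntegral.integral_const_mul,
    intervalIntegral.integral_add (i4.sub (i3.const_mul _)) (i2.const_mul _),
    intervalIntegral.integral_sub i4 (i3.const_mul _), intervalIntegral.integral_const_mul,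
    intervalIntegral.integral_const_mul]

/-- The products separate, and half the double integral of `(k u - k v)²` is `L` times the integral
of `(k - k̄)²`; hence the factor 2 in `deficit`. -/
lemma integral_integral_deficit (hw : Continuous w) (hk : Continuous k)
    (hL : (∫ u in a..b, w u) ≠ 0) :
    ∫ v in a..b, (∫ u in a..b, deficit M (k u) (k v) * w u) * w v =
      (∫ u in a..b, √(1 + k u ^ 2) * w u) ^ 2 - (∫ u in a..b, w u) ^ 2
        - (∫ u in a..b, k u * w u) ^ 2 - (∫ u in a..b, w u) / (1 + M ^ 2) *
          ∫ u in a..b, (k u - (∫ u in a..b, w u)⁻¹ * ∫ u in a..b, k u * w u) ^ 2 * w u := by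
  have i1 : IntervalIntegrable (fun u => √(1 + k u ^ 2) * w u) MeasureTheory.volume a b :=
    Continuous.intervalIntegrable (by fun_prop) a b
  have i2 : IntervalIntegrable (fun u => w u) MeasureTheory.volume a b :=
    Continuous.intervalIntegrable (by fun_prop) a b
  have i3 : IntervalIntegrable (fun u => k u * w u) MeasureTheory.volume a b :=
    Continuous.intervalIntegrable (by fun_prop) a b
  have i4 : IntervalIntegrable (fun u => k u ^ 2 * w u) MeasureTheory.volume a b :=
    Continuous.intervalIntegrable (by fun_prop) a b
  simp only [integral_deficit hw hk]
  set L := ∫ u in a..b, w u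
  set K := ∫ u in a..b, k u * w u
  set S := ∫ u in a..b, √(1 + k u ^ 2) * w u
  set Q := ∫ u in a..b, k u ^ 2 * w u with hQ
  have hV : ∫ u in a..b, (k u - L⁻¹ * K) ^ 2 * w u = Q - L⁻¹ * K ^ 2 := by
    have e : ∀ u, (k u - L⁻¹ * K) ^ 2 * w u =
        k u ^ 2 * w u - 2 * (L⁻¹ * K) * (k u * w u) + (L⁻¹ * K) ^ 2 * w u := fun u => by ring
    simp only [e]
    rw [intervalIntegral.integral_add (i4.sub (i3.const_mul _)) (i2.const_mul _),
      intervalIntegral.integral_sub i4 (i3.const_mul _), intervalIntegral.integral_const_mul,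
      intervalIntegral.integral_const_mul]
    change Q - 2 * (L⁻¹ * K) * K + (L⁻¹ * K) ^ 2 * L = _
    field_simp
    ring
  have e : ∀ v, (√(1 + k v ^ 2) * S - L - k v * K
      - (2 * (1 + M ^ 2))⁻¹ * (Q - 2 * k v * K + k v ^ 2 * L)) * w v =
      S * (√(1 + k v ^ 2) * w v) - (L + (2 * (1 + M ^ 2))⁻¹ * Q) * w v
        - (K - (1 + M ^ 2)⁻¹ * K) * (k v * w v)
        - (2 * (1 + M ^ 2))⁻¹ * L * (k v ^ 2 * w v) := fun v => by rw [mul_inv]; ring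
  simp only [e]
  rw [hV, intervalIntegral.integral_sub (((i1.const_mul _).sub (i2.const_mul _)).sub
      (i3.const_mul _)) (i4.const_mul _),
    intervalIntegral.integral_sub ((i1.const_mul _).sub (i2.const_mul _)) (i3.const_mul _),
    intervalIntegral.integral_sub (i1.const_mul _) (i2.const_mul _),
    intervalIntegral.integral_const_mul, intervalIntegral.integral_const_mul,
    intervalIntegral.integral_const_mul, intervalIntegral.integral_const_mul]
  change S * S - (L + (2 * (1 + M ^ 2))⁻¹ * Q) * L - (K - (1 + M ^ 2)⁻¹ * K) * K
    - (2 * (1 + M ^ 2))⁻¹ * L * Q = _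
  have : (1 + M ^ 2) ≠ 0 := by positivity
  field_simp
  ring

variable (hab : a < b) (hw : Continuous w) (hk : Continuous k) (hw0 : ∀ u, 0 < w u)
  (hk0 : ∀ u, 0 < k u) (hkM : ∀ u, k u ≤ M)

include hw0 hk0 hkM hab in
lemma integral_integral_deficit_nonneg :
    0 ≤ ∫ v in a..b, (∫ u in a..b, deficit M (k u) (k v) * w u) * w v :=
  intervalIntegral.integral_nonneg hab.le fun v _ => mul_nonneg
    (intervalIntegral.integral_nonneg hab.le fun u _ =>
      mul_nonneg (deficit_nonneg (hk0 u) (hk0 v) (hkM u) (hkM v)) (hw0 u).le) (hw0 v).le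

include hw hk hw0 hk0 hkM hab in
lemma integral_integral_deficit_eq_zero_iff :
    (∫ v in a..b, (∫ u in a..b, deficit M (k u) (k v) * w u) * w v) = 0 ↔
      ∀ u ∈ Set.Icc a b, ∀ v ∈ Set.Icc a b, k u = k v := by
  constructor
  · intro h u hu v hv
    by_contra hne
    refine absurd h (ne_of_gt ?_)
    refine intervalIntegral.integral_pos hab ?_ (fun v _ => ?_) ⟨v, hv, ?_⟩
    · simp only [integral_deficit hw hk]
      exact Continuous.continuousOn (by fun_prop)
    · exact mul_nonneg (intervalIntegral.integral_nonneg hab.le fun u _ =>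
        mul_nonneg (deficit_nonneg (hk0 u) (hk0 v) (hkM u) (hkM v)) (hw0 u).le) (hw0 v).le
    · refine mul_pos (intervalIntegral.integral_pos hab ?_ (fun u _ => ?_) ⟨u, hu, ?_⟩) (hw0 v)
      · unfold deficit
        exact Continuous.continuousOn (by fun_prop)
      · exact mul_nonneg (deficit_nonneg (hk0 u) (hk0 v) (hkM u) (hkM v)) (hw0 u).le
      · exact mul_pos (deficit_pos (hk0 u) (hk0 v) (hkM u) (hkM v) hne) (hw0 u)
  · intro h
    rw [intervalIntegral.integral_congr (g := fun _ => 0)]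
    · simp
    intro v hv
    rw [Set.uIcc_of_le hab.le] at hv
    change _ * _ = (0 : ℝ)
    rw [intervalIntegral.integral_congr (g := fun _ => 0)]
    · simp
    intro u hu
    rw [Set.uIcc_of_le hab.le] at hu
    change _ * _ = (0 : ℝ)
    rw [h u hu v hv, deficit_eq (hk0 v) (hk0 v)]
    simp

end

/-! ### Curves of constant geodesic curvature -/

lemma exists_mem_Ico_eq (u : ℝ) :
    ∃ v ∈ Set.Ico 0 (2 * Real.pi), ∃ n : ℤ, u = v + n • (2 * Real.pi) := by
  refine ⟨toIcoMod Real.two_pi_pos 0 u, by simpa using toIcoMod_mem_Ico Real.two_pi_pos 0 u,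
    toIcoDiv Real.two_pi_pos 0 u, ?_⟩
  rw [toIcoMod_add_toIcoDiv_zsmul]

namespace IsSmoothSimpleClosed

variable {γ : ℝ → E3} (hγ : IsSmoothSimpleClosed γ)
include hγ

/-- Differentiating `⟨γ, p⟩ = cos r` twice gives `⟨t, p⟩ = 0` and `k_g ⟨η, p⟩ = cos r`. As `p` is a
unit vector, `⟨η, p⟩² = sin² r`, so `k_g² = cot² r`, and positivity fixes the root. -/
lemma geodesicCurvature_const_of_isGeodesicCircle (hk : ∀ u, 0 < geodesicCurvature γ u)
    (h : IsGeodesicCircle γ) (u v : ℝ) : geodesicCurvature γ u = geodesicCurvature γ v := by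
  obtain ⟨p, hp, r, hr, hrange⟩ := h
  have hp1 : ‖p‖ = 1 := by simpa using hp
  have hpos : 0 < Real.sin r := Real.sin_pos_of_pos_of_lt_pi hr.1 hr.2
  have hcos : ∀ u, ⟪γ u, p⟫ = Real.cos r := fun u => by
    have h1 : γ u ∈ Set.range γ := ⟨u, rfl⟩
    rw [hrange] at h1
    have h2 : ‖γ u‖ = 1 := by simpa using h1.1
    rw [← h1.2, InnerProductGeometry.cos_angle, hp1, h2, real_inner_comm]
    simp
  have htan : ∀ u, ⟪tangent γ u, p⟫ = 0 := fun u => by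
    have h1 := (hγ.hasDerivAt u).inner ℝ (hasDerivAt_const u p)
    have h2 : HasDerivAt (fun u => ⟪γ u, p⟫) 0 u := by
      simp only [hcos]
      exact hasDerivAt_const u _
    have h3 := h1.unique h2
    rw [inner_zero_right, zero_add, inner_smul_left] at h3
    exact (mul_eq_zero.1 h3).resolve_left (hγ.speed_pos u).ne'
  have hnor : ∀ u, geodesicCurvature γ u * ⟪normal γ u, p⟫ = Real.cos r := fun u => by
    have h1 := (hγ.hasDerivAt_tangent u).inner ℝ (hasDerivAt_const u p)
    have h2 : HasDerivAt (fun u => ⟪tangent γ u, p⟫) 0 u := by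
      simp only [htan]
      exact hasDerivAt_const u _
    have h3 := h1.unique h2
    rw [inner_zero_right, zero_add, inner_smul_left] at h3
    have h4 := (mul_eq_zero.1 h3).resolve_left (hγ.speed_pos u).ne'
    rw [inner_add_left, inner_neg_left, hcos, inner_smul_left] at h4
    simp only [conj_trivial] at h4
    linarith
  have hsq : ∀ u, ⟪normal γ u, p⟫ ^ 2 = Real.sin r ^ 2 := fun u => by
    have h1 := inner_self_expansion (hγ.inner_self u) (hγ.inner_tangent_self u)
      (hγ.inner_tangent u) p
    rw [← normal, real_inner_comm (γ u) p, real_inner_comm (tangent γ u) p,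
      real_inner_comm (normal γ u) p, hcos, htan, real_inner_self_eq_norm_sq, hp1] at h1
    linarith [Real.sin_sq_add_cos_sq r]
  have hfin : ∀ u, geodesicCurvature γ u ^ 2 = (Real.cos r / Real.sin r) ^ 2 := fun u => by
    rw [div_pow, eq_div_iff (by positivity), ← hsq u, ← mul_pow, hnor]
  exact (pow_left_inj₀ (hk u).le (hk v).le two_ne_zero).1 ((hfin u).trans (hfin v).symm)

/-- A closed curve in a circle, with nonvanishing velocity, covers the circle. -/
lemma exists_eq_of_inner_eq {c x : E3} {κ : ℝ} (hc : ∀ u, κ • γ u + normal γ u = c)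
    (hx : ⟪x, x⟫ = 1) (hxc : ⟪x, c⟫ = κ) : x ∈ Set.range γ := by
  by_contra hne
  have hcγ : ∀ u, ⟪γ u, c⟫ = κ := fun u => by
    rw [← hc u, inner_add_right, inner_smul_right, hγ.inner_self, inner_normal]; ring
  -- a point of the circle at which the distance to `x` is critical is the antipode of `x`
  have hcrit : ∀ u, ⟪tangent γ u, x⟫ = 0 → (1 + κ ^ 2) * ⟪γ u, x⟫ = κ ^ 2 - 1 := fun u hu => by
    have h1 := inner_self_expansion (hγ.inner_self u) (hγ.inner_tangent_self u)
      (hγ.inner_tangent u) x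
    rw [← normal, hx, real_inner_comm (tangent γ u), hu, real_inner_comm (γ u)] at h1
    have h2 : κ * ⟪γ u, x⟫ + ⟪x, normal γ u⟫ = κ := by
      rw [← hc u, inner_add_right, inner_smul_right, real_inner_comm (γ u)] at hxc
      exact hxc
    have h3 : ⟪x, normal γ u⟫ = κ - κ * ⟪γ u, x⟫ := by linarith
    rw [h3] at h1
    -- The quadratic for `⟨γ u, x⟩` has two roots: 1, meaning `γ u = x`, and the value at the
    -- antipode of `x` on the circle.
    have h4 : (⟪γ u, x⟫ - 1) * ((1 + κ ^ 2) * ⟪γ u, x⟫ - (κ ^ 2 - 1)) = 0 := by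
      linear_combination -h1
    rcases mul_eq_zero.1 h4 with h5 | h5
    · exfalso
      apply hne
      refine ⟨u, ?_⟩
      have h6 : ⟪γ u - x, γ u - x⟫ = 0 := by
        rw [inner_sub_left, inner_sub_right, inner_sub_right, hγ.inner_self, hx,
          real_inner_comm (γ u) x]
        linarith
      exact sub_eq_zero.1 (inner_self_eq_zero.1 h6)
    · linarith
  have hd : ∀ u, HasDerivAt (fun u => ⟪γ u, x⟫) (speed γ u * ⟪tangent γ u, x⟫) u := fun u => by
    have h1 := (hγ.hasDerivAt u).inner ℝ (hasDerivAt_const u x)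
    rw [inner_zero_right, zero_add, inner_smul_left] at h1
    exact h1
  have hcont : Continuous fun u => ⟪γ u, x⟫ := hγ.continuous.inner continuous_const
  have hper : ∀ u, ∃ v ∈ Set.Icc 0 (2 * Real.pi), γ u = γ v := fun u => by
    obtain ⟨v, hv, n, rfl⟩ := exists_mem_Ico_eq u
    exact ⟨v, Set.Ico_subset_Icc_self hv, hγ.periodic.zsmul n v⟩
  have hne' : (Set.Icc 0 (2 * Real.pi)).Nonempty := Set.nonempty_Icc.2 Real.two_pi_pos.le
  obtain ⟨m, -, hm⟩ := isCompact_Icc.exists_isMinOn hne' hcont.continuousOn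
  obtain ⟨m', -, hm'⟩ := isCompact_Icc.exists_isMaxOn hne' hcont.continuousOn
  have hm1 : ∀ u, ⟪γ m, x⟫ ≤ ⟪γ u, x⟫ := fun u => by
    obtain ⟨v, hv, e⟩ := hper u
    rw [e]
    exact hm hv
  have hm1' : ∀ u, ⟪γ u, x⟫ ≤ ⟪γ m', x⟫ := fun u => by
    obtain ⟨v, hv, e⟩ := hper u
    rw [e]
    exact hm' hv
  have hz : ∀ u, speed γ u * ⟪tangent γ u, x⟫ = 0 → ⟪tangent γ u, x⟫ = 0 := fun u hu =>
    (mul_eq_zero.1 hu).resolve_left (hγ.speed_pos u).ne'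
  have e1 := hcrit m (hz m (IsLocalMin.hasDerivAt_eq_zero (Filter.Eventually.of_forall hm1) (hd m)))
  have e2 := hcrit m'
    (hz m' (IsLocalMax.hasDerivAt_eq_zero (Filter.Eventually.of_forall hm1') (hd m')))
  -- Minimum and maximum of `⟨γ, x⟩` are both critical values, hence equal, so this function is
  -- constant.
  have hpos : 0 < 1 + κ ^ 2 := by positivity
  have e3 : ⟪γ m, x⟫ = ⟪γ m', x⟫ := mul_left_cancel₀ hpos.ne' (e1.trans e2.symm)
  have hconst : ∀ u, ⟪γ u, x⟫ = ⟪γ m, x⟫ := fun u => le_antisymm (e3 ▸ hm1' u) (hm1 u)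
  have ht0 : ∀ u, ⟪tangent γ u, x⟫ = 0 := fun u => by
    apply hz
    have h2 : HasDerivAt (fun u => ⟪γ u, x⟫) 0 u := by
      simp only [hconst]
      exact hasDerivAt_const u _
    exact (hd u).unique h2
  -- then `γ` is constantly the antipode of `x`
  have hd2 := (hγ.hasDerivAt_tangent 0).inner ℝ (hasDerivAt_const 0 x)
  rw [inner_zero_right, zero_add, inner_smul_left] at hd2
  have h2 : HasDerivAt (fun u => ⟪tangent γ u, x⟫) 0 0 := by
    simp only [ht0]
    exact hasDerivAt_const _ _
  have hd3 := (mul_eq_zero.1 (hd2.unique h2)).resolve_left (hγ.speed_pos 0).ne'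
  have hγk : geodesicCurvature γ 0 = κ := by
    have h4 : HasDerivAt (fun u => ⟪tangent γ u, c⟫)
        ⟪speed γ 0 • (-γ 0 + geodesicCurvature γ 0 • normal γ 0), c⟫ 0 := by
      simpa using (hγ.hasDerivAt_tangent 0).inner ℝ (hasDerivAt_const 0 c)
    have h5 : ∀ u, ⟪tangent γ u, c⟫ = 0 := fun u => by
      rw [← hc u, inner_add_right, inner_smul_right, real_inner_comm, hγ.inner_tangent,
        inner_tangent_normal]; ring
    simp only [h5] at h4
    have h6 := h4.unique (hasDerivAt_const _ _)
    rw [inner_smul_left, inner_add_left, inner_neg_left, hcγ, inner_smul_left] at h6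
    have h7 : ⟪normal γ 0, c⟫ = 1 := by
      rw [← hc 0, inner_add_right, inner_smul_right, real_inner_comm, inner_normal,
        hγ.inner_normal_self]; ring
    rw [h7] at h6
    have h8 := (mul_eq_zero.1 h6).resolve_left (hγ.speed_pos 0).ne'
    simp only [conj_trivial] at h8
    linarith
  rw [inner_add_left, inner_neg_left, inner_smul_left, hγk] at hd3
  simp only [conj_trivial] at hd3
  have h9 : κ * ⟪γ 0, x⟫ + ⟪x, normal γ 0⟫ = κ := by
    rw [← hc 0, inner_add_right, inner_smul_right, real_inner_comm (γ 0)] at hxc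
    exact hxc
  rw [real_inner_comm (normal γ 0) x] at h9
  have e4 := hcrit 0 (ht0 0)
  have : (1 : ℝ) = 0 := by linear_combination e4 - κ * h9 + hd3
  norm_num at this

/-- The vector `c = κ γ + η` has derivative `κ t - κ t = 0`. Its direction is the centre, and `cos r
= κ/√(1 + κ²)`. -/
lemma isGeodesicCircle_of_geodesicCurvature_const {κ : ℝ}
    (h : ∀ u, geodesicCurvature γ u = κ) : IsGeodesicCircle γ := by
  have hconst : ∀ u, κ • γ u + normal γ u = κ • γ 0 + normal γ 0 := by
    have hd : ∀ u, HasDerivAt (fun u => κ • γ u + normal γ u) 0 u := fun u => by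
      have h1 := ((hγ.hasDerivAt u).const_smul κ).add (hγ.hasDerivAt_normal u)
      rw [h u] at h1
      have e : κ • speed γ u • tangent γ u + -(speed γ u * κ) • tangent γ u = 0 := by module
      rw [← e]
      exact h1
    intro u
    exact is_const_of_deriv_eq_zero (fun u => (hd u).differentiableAt) (fun u => (hd u).deriv) u 0
  set c := κ • γ 0 + normal γ 0
  have hcc : ⟪c, c⟫ = 1 + κ ^ 2 := by
    simp only [c, inner_add_left, inner_add_right, inner_smul_left, inner_smul_right,
      hγ.inner_self, inner_normal, hγ.inner_normal_self, real_inner_comm (γ 0) (normal γ 0)]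
    simp
    ring
  have hcγ : ∀ u, ⟪γ u, c⟫ = κ := fun u => by
    rw [← hconst u, inner_add_right, inner_smul_right, hγ.inner_self, inner_normal]; ring
  have hpos : 0 < 1 + κ ^ 2 := by positivity
  have hnorm : ‖c‖ = √(1 + κ ^ 2) := by
    rw [← hcc, real_inner_self_eq_norm_sq, Real.sqrt_sq (norm_nonneg _)]
  have hn0 : 0 < ‖c‖ := by rw [hnorm]; positivity
  have hlt : |κ / ‖c‖| < 1 := by
    rw [abs_div, abs_of_pos hn0, div_lt_one hn0, hnorm]
    apply Real.lt_sqrt_of_sq_lt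
    rw [sq_abs]
    linarith
  have hlt' := abs_lt.1 hlt
  refine ⟨‖c‖⁻¹ • c, ?_, Real.arccos (κ / ‖c‖), ⟨Real.arccos_pos.2 hlt'.2, ?_⟩, ?_⟩
  · rw [mem_sphere_zero_iff_norm, norm_smul, norm_inv, norm_norm, inv_mul_cancel₀ hn0.ne']
  · rw [← Real.arccos_neg_one]
    exact Real.arccos_lt_arccos le_rfl hlt'.1 hlt'.2.le
  ext x
  have hang : ∀ x : E3, ‖x‖ = 1 → InnerProductGeometry.angle (‖c‖⁻¹ • c) x =
      Real.arccos (⟪x, c⟫ / ‖c‖) := fun x hx => by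
    rw [InnerProductGeometry.angle_smul_left_of_pos _ _ (inv_pos.2 hn0), InnerProductGeometry.angle,
      hx, mul_one, real_inner_comm]
  constructor
  · rintro ⟨u, rfl⟩
    have hu : ‖γ u‖ = 1 := by simpa using hγ.mem_sphere u
    exact ⟨hγ.mem_sphere u, by rw [hang _ hu, hcγ]⟩
  · rintro ⟨hx, hx2⟩
    have hx1 : ‖x‖ = 1 := by simpa using hx
    rw [hang x hx1] at hx2
    apply hγ.exists_eq_of_inner_eq (κ := κ) hconst
    · rw [real_inner_self_eq_norm_sq, hx1, one_pow]
    have hb : |⟪x, c⟫ / ‖c‖| ≤ 1 := by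
      rw [abs_div, abs_of_pos hn0, div_le_one hn0]
      simpa [hx1] using abs_real_inner_le_norm x c
    have hb' := abs_le.1 hb
    have := Real.arccos_injOn ⟨hb'.1, hb'.2⟩ ⟨hlt'.1.le, hlt'.2.le⟩ hx2
    rwa [div_left_inj' hn0.ne'] at this

end IsSmoothSimpleClosed

/-! ### The cone over a region of the sphere -/

/-- A preconnected set that misses the frontier of an open set lies inside or outside of it. -/
lemma subset_or_disjoint_closure {X : Type*} [TopologicalSpace X] {s C : Set X}
    (hs : IsPreconnected s) (hC : IsOpen C) (h : Disjoint s (frontier C)) :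
    s ⊆ C ∨ Disjoint s (closure C) := by
  have h1 := isPreconnected_iff_subset_of_disjoint.1 hs C (closure C)ᶜ hC
    isClosed_closure.isOpen_compl
    (fun x hx => ?_) ?_
  · exact h1.imp id Set.subset_compl_iff_disjoint_right.1
  · by_contra hne
    simp only [Set.mem_union, Set.mem_compl_iff, not_or, not_not] at hne
    exact Set.disjoint_left.1 h hx ⟨hne.2, fun hi => hne.1 (interior_subset hi)⟩
  · ext x
    simp only [Set.mem_inter_iff, Set.mem_compl_iff, Set.mem_empty_iff_false, iff_false, not_and,
      not_not]
    exact fun _ hx => subset_closure hx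

/-- The open cone over a subset of the sphere. -/
def cone (Ω : Set S2) : Set E3 := {x | ∃ y ∈ Ω, ∃ r : ℝ, 0 < r ∧ x = r • (y : E3)}

lemma norm_coe_S2 (y : S2) : ‖(y : E3)‖ = 1 := by simp

lemma cone_eq_preimage (Ω : Set S2) :
    cone Ω = {x | x ≠ 0 ∧ ‖x‖⁻¹ • x ∈ (Subtype.val '' Ω : Set E3)} := by
  ext x
  constructor
  · rintro ⟨y, hy, r, hr, rfl⟩
    have hy1 := norm_coe_S2 y
    have hn : ‖r • (y : E3)‖ = r := by rw [norm_smul, hy1, mul_one, Real.norm_of_nonneg hr.le]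
    refine ⟨norm_pos_iff.1 (by rw [hn]; exact hr), y, hy, ?_⟩
    rw [hn, smul_smul, inv_mul_cancel₀ hr.ne', one_smul]
  · rintro ⟨hx, y, hy, h⟩
    have hn : 0 < ‖x‖ := norm_pos_iff.2 hx
    exact ⟨y, hy, ‖x‖, hn, by rw [h, smul_smul, mul_inv_cancel₀ hn.ne', one_smul]⟩

lemma smul_mem_cone {Ω : Set S2} {x : E3} (hx : x ∈ cone Ω) {r : ℝ} (hr : 0 < r) :
    r • x ∈ cone Ω := by
  obtain ⟨y, hy, s, hs, rfl⟩ := hx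
  exact ⟨y, hy, r * s, mul_pos hr hs, by rw [smul_smul]⟩

lemma coe_mem_cone {Ω : Set S2} {y : S2} : (y : E3) ∈ cone Ω ↔ y ∈ Ω := by
  rw [cone_eq_preimage]
  simp only [ne_eq, Set.mem_ofPred_eq, norm_coe_S2, inv_one, one_smul,
    Subtype.val_injective.mem_set_image,
    and_iff_right_iff_imp]
  intro _ h
  simpa [h] using norm_coe_S2 y

lemma zero_notMem_cone (Ω : Set S2) : (0 : E3) ∉ cone Ω := by
  rw [cone_eq_preimage]
  simp

lemma continuousAt_normalize {x : E3} (hx : x ≠ 0) : ContinuousAt (fun x : E3 => ‖x‖⁻¹ • x) x :=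
  (continuous_norm.continuousAt.inv₀ (norm_ne_zero_iff.2 hx)).smul continuousAt_id

lemma isOpen_cone {Ω : Set S2} (hΩ : IsOpen Ω) : IsOpen (cone Ω) := by
  obtain ⟨W, hW, rfl⟩ := isOpen_induced_iff.1 hΩ
  have : cone (Subtype.val ⁻¹' W) = {x | x ≠ 0} ∩ (fun x : E3 => ‖x‖⁻¹ • x) ⁻¹' W := by
    rw [cone_eq_preimage]
    ext x
    simp only [Set.mem_ofPred_eq, Set.mem_inter_iff, Set.mem_preimage]
    refine and_congr_right fun hx => ⟨?_, fun h => ?_⟩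
    · rintro ⟨y, hy, h⟩
      rw [← h]
      exact hy
    · refine ⟨⟨‖x‖⁻¹ • x, ?_⟩, h, rfl⟩
      rw [mem_sphere_zero_iff_norm, norm_smul, norm_inv, norm_norm,
        inv_mul_cancel₀ (norm_ne_zero_iff.2 hx)]
  rw [this]
  exact ContinuousOn.isOpen_inter_preimage
    (fun x hx => (continuousAt_normalize hx).continuousWithinAt) isOpen_ne hW

lemma isConnected_cone {Ω : Set S2} (hΩ : IsConnected Ω) : IsConnected (cone Ω) := by
  have : cone Ω = (fun p : ℝ × S2 => p.1 • (p.2 : E3)) '' (Set.Ioi 0 ×ˢ Ω) := by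
    ext x
    constructor
    · rintro ⟨y, hy, r, hr, rfl⟩
      exact ⟨(r, y), ⟨hr, hy⟩, rfl⟩
    · rintro ⟨⟨r, y⟩, ⟨hr, hy⟩, rfl⟩
      exact ⟨y, hy, r, hr, rfl⟩
  rw [this]
  exact (isConnected_Ioi.prod hΩ).image _ (by fun_prop)

lemma exists_of_mem_frontier_cone {γ : ℝ → E3} {Ω : Set S2} (hΩ : IsEnclosedRegion γ Ω) {x : E3}
    (hx : x ∈ frontier (cone Ω)) (hx0 : x ≠ 0) : ∃ u, ∃ r : ℝ, 0 < r ∧ x = r • γ u := by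
  have hn : 0 < ‖x‖ := norm_pos_iff.2 hx0
  let y : S2 := ⟨‖x‖⁻¹ • x, by
    rw [mem_sphere_zero_iff_norm, norm_smul, norm_inv, norm_norm, inv_mul_cancel₀ hn.ne']⟩
  have hxy : x = ‖x‖ • (y : E3) := by
    change x = ‖x‖ • ‖x‖⁻¹ • x
    rw [smul_smul, mul_inv_cancel₀ hn.ne', one_smul]
  have hy : y ∈ frontier Ω := by
    constructor
    · rw [closure_subtype]
      refine (continuousAt_normalize hx0).continuousWithinAt.mem_closure hx.1 fun z hz => ?_
      rw [cone_eq_preimage] at hz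
      exact hz.2
    · intro hi
      refine hx.2 ?_
      rw [(isOpen_cone hΩ.isOpen).interior_eq, hxy]
      exact smul_mem_cone (coe_mem_cone.2 (interior_subset hi)) hn
  rw [hΩ.frontier_eq] at hy
  obtain ⟨u, hu⟩ := hy
  exact ⟨u, ‖x‖, hn, by rw [hu]; exact hxy⟩

lemma mem_frontier_cone {γ : ℝ → E3} (hγ : IsSmoothSimpleClosed γ) {Ω : Set S2}
    (hΩ : IsEnclosedRegion γ Ω) (u : ℝ) : γ u ∈ frontier (cone Ω) := by
  have hy : (⟨γ u, hγ.mem_sphere u⟩ : S2) ∈ frontier Ω := by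
    rw [hΩ.frontier_eq]
    exact ⟨u, rfl⟩
  constructor
  · refine closure_mono ?_ (closure_subtype.1 hy.1)
    rintro _ ⟨y, hy, rfl⟩
    exact coe_mem_cone.2 hy
  · rw [(isOpen_cone hΩ.isOpen).interior_eq]
    intro h
    refine hy.2 ?_
    rw [hΩ.isOpen.interior_eq]
    exact (coe_mem_cone (y := ⟨γ u, hγ.mem_sphere u⟩)).1 h

lemma notMem_cone {γ : ℝ → E3} (hγ : IsSmoothSimpleClosed γ) {Ω : Set S2}
    (hΩ : IsEnclosedRegion γ Ω) (u : ℝ) : γ u ∉ cone Ω := fun h =>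
  (mem_frontier_cone hγ hΩ u).2 (by rwa [(isOpen_cone hΩ.isOpen).interior_eq])

lemma smul_mem_closure_cone {Ω : Set S2} {x : E3} (hx : x ∈ closure (cone Ω)) {r : ℝ} (hr : 0 < r) :
    r • x ∈ closure (cone Ω) :=
  map_mem_closure (continuous_const_smul r) hx fun _ hy => smul_mem_cone hy hr

/-! ### Local convexity -/

section

variable {γ : ℝ → E3} (hγ : IsSmoothSimpleClosed γ)
include hγ

lemma IsSmoothSimpleClosed.exists_zsmul_of_eq {u v : ℝ} (h : γ u = γ v) :
    ∃ n : ℤ, u = v + n • (2 * Real.pi) := by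
  obtain ⟨u', hu', n, rfl⟩ := exists_mem_Ico_eq u
  obtain ⟨v', hv', m, rfl⟩ := exists_mem_Ico_eq v
  rw [hγ.periodic.zsmul n u', hγ.periodic.zsmul m v'] at h
  rw [hγ.simple hu' hv' h]
  exact ⟨n - m, by rw [sub_smul]; ring⟩

/-- The height over the tangent plane at `γ v` has derivative `speed · ⟨t, η v⟩`. The factor `⟨t, η
v⟩` vanishes at `v` and has positive derivative there because `k_g > 0`, so it has the sign of `u -
v`; the mean value theorem concludes. -/
lemma inner_normal_pos_of_near (hk : ∀ u, 0 < geodesicCurvature γ u) (v : ℝ) :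
    ∃ ε > 0, ∀ u, |u - v| < ε → u ≠ v → 0 < ⟪γ u, normal γ v⟫ := by
  have hh : HasDerivAt (fun u => ⟪tangent γ u, normal γ v⟫)
      (speed γ v * geodesicCurvature γ v) v := by
    have h := (hγ.hasDerivAt_tangent v).inner ℝ (hasDerivAt_const v (normal γ v))
    rw [inner_zero_right, zero_add, inner_smul_left, inner_add_left, inner_neg_left,
      inner_smul_left, inner_normal, hγ.inner_normal_self] at h
    simpa using h
  have hg : ∀ u, HasDerivAt (fun u => ⟪γ u, normal γ v⟫)
      (speed γ u * ⟪tangent γ u, normal γ v⟫) u := fun u => by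
    have h := (hγ.hasDerivAt u).inner ℝ (hasDerivAt_const u (normal γ v))
    rw [inner_zero_right, zero_add, inner_smul_left] at h
    simpa using h
  have hs := eventually_nhdsWithin_sign_eq_of_deriv_pos
    (f := fun u => ⟪tangent γ u, normal γ v⟫) (x₀ := v)
    (by rw [hh.deriv]; exact mul_pos (hγ.speed_pos v) (hk v)) (inner_tangent_normal γ v)
  obtain ⟨ε, hε, hs⟩ := Metric.eventually_nhds_iff.1 hs
  have hcont : Continuous fun u => ⟪γ u, normal γ v⟫ := hγ.continuous.inner continuous_const
  refine ⟨ε, hε, fun u hu hne => ?_⟩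
  rcases lt_or_gt_of_ne hne with h | h
  · obtain ⟨c, hc, hc2⟩ := exists_hasDerivAt_eq_slope (fun u => ⟪γ u, normal γ v⟫) _ h
      hcont.continuousOn fun x _ => hg x
    have h1 := hs (y := c) (by
      rw [Real.dist_eq, abs_lt]; rw [abs_lt] at hu; constructor <;> linarith [hc.1, hc.2])
    rw [sign_neg (sub_neg.2 hc.2), sign_eq_neg_one_iff] at h1
    rw [inner_normal, eq_div_iff (by linarith)] at hc2
    nlinarith [mul_pos (hγ.speed_pos c) (mul_pos (neg_pos.2 h1) (sub_pos.2 h))]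
  · obtain ⟨c, hc, hc2⟩ := exists_hasDerivAt_eq_slope (fun u => ⟪γ u, normal γ v⟫) _ h
      hcont.continuousOn fun x _ => hg x
    have h1 := hs (y := c) (by
      rw [Real.dist_eq, abs_lt]; rw [abs_lt] at hu; constructor <;> linarith [hc.1, hc.2])
    rw [sign_pos (sub_pos.2 hc.1), sign_eq_one_iff] at h1
    rw [inner_normal, eq_div_iff (by linarith)] at hc2
    nlinarith [mul_pos (hγ.speed_pos c) (mul_pos h1 (sub_pos.2 h))]

/-- Near `γ v`, the cone over `γ` lies strictly on the inner side of its tangent plane. -/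
lemma eventually_eq_of_inner_normal_nonpos (hk : ∀ u, 0 < geodesicCurvature γ u) (v : ℝ) :
    ∀ᶠ p in 𝓝 (γ v), ∀ u, ∀ r : ℝ, 0 < r → p = r • γ u → ⟪p, normal γ v⟫ ≤ 0 → γ u = γ v := by
  obtain ⟨ε, hε, hpos⟩ := inner_normal_pos_of_near hγ hk v
  -- The part of one period at parameter distance at least `ε` from `v`: compact, and avoiding `γ v`
  -- by simplicity. Points near `γ v` thus project radially off `K`.
  let K : Set E3 := γ '' (Set.Icc (v - Real.pi) (v + Real.pi) ∩ {u | ε ≤ |u - v|})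
  have hK : IsCompact K := (isCompact_Icc.inter_right
    (isClosed_le continuous_const (by fun_prop))).image hγ.continuous
  have hvK : γ v ∉ K := by
    rintro ⟨u, ⟨hu, hu2⟩, h⟩
    obtain ⟨n, hn⟩ := hγ.exists_zsmul_of_eq h
    rw [zsmul_eq_mul] at hn
    have hpi := Real.pi_pos
    have h1 : (n : ℝ) < 1 := by nlinarith [hu.1, hu.2]
    have h2 : (-1 : ℝ) < n := by nlinarith [hu.1, hu.2]
    have h3 : n = 0 := by
      have : n < 1 := by exact_mod_cast h1
      have : -1 < n := by exact_mod_cast h2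
      omega
    rw [h3] at hn
    simp only [Int.cast_zero, zero_mul, add_zero] at hn
    rw [hn] at hu2
    simp only [Set.mem_ofPred_eq, sub_self, abs_zero] at hu2
    linarith
  have hv1 : ‖γ v‖ = 1 := by simpa using hγ.mem_sphere v
  have hv0 : γ v ≠ 0 := norm_ne_zero_iff.1 (by rw [hv1]; exact one_ne_zero)
  have hev : ∀ᶠ p in 𝓝 (γ v), ‖p‖⁻¹ • p ∈ Kᶜ := by
    refine (continuousAt_normalize hv0).eventually_mem ?_
    rw [hv1, inv_one, one_smul]
    exact hK.isClosed.isOpen_compl.mem_nhds hvK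
  filter_upwards [hev] with p hp u r hr hpr hle
  have hu1 : ‖γ u‖ = 1 := by simpa using hγ.mem_sphere u
  rw [hpr, norm_smul, hu1, mul_one, Real.norm_of_nonneg hr.le, smul_smul, inv_mul_cancel₀ hr.ne',
    one_smul] at hp
  obtain ⟨u', hu', n, rfl⟩ : ∃ u' ∈ Set.Ico (v - Real.pi) (v + Real.pi), ∃ n : ℤ,
      u = u' + n • (2 * Real.pi) := by
    refine ⟨toIcoMod Real.two_pi_pos (v - Real.pi) u, ?_, toIcoDiv Real.two_pi_pos (v - Real.pi) u,
      by rw [toIcoMod_add_toIcoDiv_zsmul]⟩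
    have h := toIcoMod_mem_Ico Real.two_pi_pos (v - Real.pi) u
    rwa [show v - Real.pi + 2 * Real.pi = v + Real.pi by ring] at h
  rw [hγ.periodic.zsmul n u'] at hp hpr ⊢
  by_contra hne
  have hlt : |u' - v| < ε := by
    by_contra hge
    exact hp ⟨u', ⟨Set.Ico_subset_Icc_self hu', not_lt.1 hge⟩, rfl⟩
  have := hpos u' hlt fun h => hne (by rw [h])
  rw [hpr, inner_smul_left] at hle
  simp only [conj_trivial] at hle
  nlinarith [mul_pos hr this]

variable {Ω : Set S2} (hΩ : IsEnclosedRegion γ Ω) (hk : ∀ u, 0 < geodesicCurvature γ u)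
include hΩ hk

/-- Near `γ v`, the closed cone over `Ω` lies strictly on the inner side of the tangent plane. -/
lemma eventually_outside (v : ℝ) : ∀ᶠ p in 𝓝 (γ v), ⟪p, normal γ v⟫ ≤ 0 →
    p ∈ closure (cone Ω) → ∃ r : ℝ, p = r • γ v := by
  obtain ⟨ρ, hρ, hb⟩ := Metric.eventually_nhds_iff_ball.1
    (eventually_eq_of_inner_normal_nonpos hγ hk v)
  have hv1 : ‖γ v‖ = 1 := by simpa using hγ.mem_sphere v
  -- Radius at most 1 keeps the apex 0 out of the open ball.
  set ρ' := min ρ 1 with hρ'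
  have hρ'0 : 0 < ρ' := lt_min hρ one_pos
  let H₀ : Set E3 := Metric.ball (γ v) ρ' ∩ {p | ⟪p, normal γ v⟫ < 0}
  -- `H` lies between the convex set `H₀` and its closure, hence is connected, and it misses the
  -- frontier of the cone. The outward condition on `γ` then puts it outside the closed cone.
  let H : Set E3 := {p | p ∈ Metric.ball (γ v) ρ' ∧ ⟪p, normal γ v⟫ ≤ 0 ∧ ¬∃ r : ℝ, p = r • γ v}
  have hH₀ : IsPreconnected H₀ := by
    refine ((convex_ball _ _).inter ?_).isPreconnected
    refine convex_halfSpace_lt (f := fun p : E3 => ⟪p, normal γ v⟫)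
      ⟨fun x y => inner_add_left _ _ _, fun c x => ?_⟩ 0
    rw [inner_smul_left]; simp
  have h01 : H₀ ⊆ H := by
    rintro p ⟨hp1, hp2⟩
    refine ⟨hp1, le_of_lt hp2, ?_⟩
    rintro ⟨r, rfl⟩
    rw [Set.mem_ofPred_eq, inner_smul_left, inner_normal] at hp2
    simp at hp2
  have h10 : H ⊆ closure H₀ := by
    rintro p ⟨hp1, hp2, -⟩
    have hc : Continuous fun δ : ℝ => p - δ • normal γ v := by fun_prop
    have ht : Filter.Tendsto (fun δ : ℝ => p - δ • normal γ v) (𝓝[>] 0) (𝓝 p) := by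
      have := hc.tendsto 0
      simp only [zero_smul, sub_zero] at this
      exact this.mono_left nhdsWithin_le_nhds
    refine mem_closure_of_tendsto ht ?_
    filter_upwards [ht.eventually_mem (Metric.isOpen_ball.mem_nhds hp1), self_mem_nhdsWithin]
      with δ h1 h2
    refine ⟨h1, ?_⟩
    rw [Set.mem_ofPred_eq, inner_sub_left, inner_smul_left, hγ.inner_normal_self]
    have : (0 : ℝ) < δ := h2
    simp only [conj_trivial]
    linarith
  have hH : IsPreconnected H := hH₀.subset_closure h01 h10
  have hdisj : Disjoint H (frontier (cone Ω)) := by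
    rw [Set.disjoint_left]
    rintro p ⟨hp1, hp2, hp3⟩ hpf
    have hp0 : p ≠ 0 := by
      rintro rfl
      rw [Metric.mem_ball, dist_zero_left, hv1] at hp1
      exact absurd hp1 (not_lt.2 (min_le_right _ _))
    obtain ⟨u, r, hr, hpr⟩ := exists_of_mem_frontier_cone hΩ hpf hp0
    refine hp3 ⟨r, ?_⟩
    rw [hpr, hb p (Metric.ball_subset_ball (min_le_left _ _) hp1) u r hr hpr hp2]
  have hnot : ¬H ⊆ cone Ω := by
    intro hsub
    have ht : Filter.Tendsto (fun ε : ℝ => Real.cos ε • γ v - Real.sin ε • normal γ v)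
        (𝓝[>] 0) (𝓝 (γ v)) := by
      have hc : Continuous fun ε : ℝ => Real.cos ε • γ v - Real.sin ε • normal γ v := by fun_prop
      have := hc.tendsto 0
      simp only [Real.cos_zero, Real.sin_zero, zero_smul, sub_zero, one_smul] at this
      exact this.mono_left nhdsWithin_le_nhds
    obtain ⟨ε, h1, h2, h3⟩ := ((hΩ.outward v).and
      ((ht.eventually_mem (Metric.isOpen_ball.mem_nhds (Metric.mem_ball_self hρ'0))).and
        (Ioo_mem_nhdsGT Real.pi_pos))).exists
    have hsin := Real.sin_pos_of_pos_of_lt_pi h3.1 h3.2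
    have hmem : Real.cos ε • γ v - Real.sin ε • normal γ v ∈ cone Ω := by
      refine hsub (h01 ⟨h2, ?_⟩)
      rw [Set.mem_ofPred_eq, inner_sub_left, inner_smul_left, inner_smul_left,
        hγ.inner_normal_self, inner_normal]
      simp only [conj_trivial]
      linarith
    rw [cone_eq_preimage] at hmem
    have hn : ‖Real.cos ε • γ v - Real.sin ε • normal γ v‖ = 1 := by
      have : ‖Real.cos ε • γ v - Real.sin ε • normal γ v‖ ^ 2 = 1 := by
        rw [← real_inner_self_eq_norm_sq]
        simp only [inner_sub_left, inner_sub_right, inner_smul_left, inner_smul_right,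
          hγ.inner_self, inner_normal, hγ.inner_normal_self, real_inner_comm (γ v) (normal γ v)]
        simp only [conj_trivial]
        linarith [Real.sin_sq_add_cos_sq ε]
      exact (pow_eq_one_iff_of_nonneg (norm_nonneg _) two_ne_zero).1 this
    rw [Set.mem_ofPred_eq, hn, inv_one, one_smul] at hmem
    exact h1 hmem.2
  have hout := (subset_or_disjoint_closure hH (isOpen_cone hΩ.isOpen) hdisj).resolve_left hnot
  filter_upwards [Metric.ball_mem_nhds (γ v) hρ'0] with p hp hle hcl
  by_contra hne
  exact Set.disjoint_left.1 hout ⟨hp, hle, hne⟩ hcl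

/-- A straight path in the closed cone touches the boundary of the cone only radially. -/
lemma exists_smul_of_tangent {z d : E3} (hz : z ∈ frontier (cone Ω)) (hz0 : z ≠ 0)
    (h : ∀ᶠ τ in 𝓝 (0 : ℝ), Real.cos τ • z + Real.sin τ • d ∈ closure (cone Ω)) :
    ∃ c : ℝ, d = c • z := by
  obtain ⟨v, r, hr, rfl⟩ := exists_of_mem_frontier_cone hΩ hz hz0
  have hc : Continuous fun τ : ℝ => Real.cos τ • γ v + Real.sin τ • r⁻¹ • d := by fun_prop
  have ht := hc.tendsto 0
  simp only [Real.cos_zero, Real.sin_zero, zero_smul, add_zero, one_smul] at ht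
  have h1 := (ht.eventually (eventually_outside hγ hΩ hk v)).and h
  have h1neg : ∀ᶠ τ in 𝓝 (0 : ℝ), _ := (continuous_neg.tendsto' (0 : ℝ) 0 neg_zero).eventually h1
  obtain ⟨τ, ⟨⟨a1, a2⟩, b1, b2⟩, hτ⟩ := (((h1.and h1neg).filter_mono
    (nhdsWithin_le_nhds (s := Set.Ioi 0))).and (Ioo_mem_nhdsGT Real.pi_pos)).exists
  have hsin := Real.sin_pos_of_pos_of_lt_pi hτ.1 hτ.2
  have key : ∀ τ : ℝ, Real.sin τ ≠ 0 →
      Real.cos τ • r • γ v + Real.sin τ • d ∈ closure (cone Ω) →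
      ((Real.cos τ • γ v + Real.sin τ • r⁻¹ • d) ∈ closure (cone Ω) →
        ∃ c : ℝ, Real.cos τ • γ v + Real.sin τ • r⁻¹ • d = c • γ v) →
      ∃ c : ℝ, d = c • r • γ v := by
    intro τ hs h2 h3
    obtain ⟨c, hc⟩ := h3 (by
      have := smul_mem_closure_cone h2 (inv_pos.2 hr)
      convert this using 1
      rw [smul_add, smul_comm r⁻¹ (Real.sin τ), smul_comm r⁻¹ (Real.cos τ), smul_smul r⁻¹ r,
        inv_mul_cancel₀ hr.ne', one_smul])
    refine ⟨(c - Real.cos τ) / Real.sin τ, ?_⟩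
    have h4 : Real.sin τ • r⁻¹ • d = (c - Real.cos τ) • γ v := by
      rw [sub_smul, ← hc]; abel
    have h5 : d = (Real.sin τ)⁻¹ • r • Real.sin τ • r⁻¹ • d := by
      rw [smul_comm r (Real.sin τ), smul_smul r, mul_inv_cancel₀ hr.ne', one_smul, smul_smul,
        inv_mul_cancel₀ hs, one_smul]
    rw [h5, h4]
    simp only [smul_smul]
    congr 1
    ring
  -- One of the two directions `±τ` lands on the outer side of the tangent plane, where the closed
  -- cone contains only multiples of `γ v`.
  rcases le_total ⟪r⁻¹ • d, normal γ v⟫ 0 with hle | hle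
  · refine key τ hsin.ne' a2 fun h => a1 ?_ h
    rw [inner_add_left, inner_smul_left, inner_normal, inner_smul_left]
    simp only [conj_trivial]
    nlinarith
  · refine key (-τ) (by rw [Real.sin_neg]; exact neg_ne_zero.2 hsin.ne') b2 fun h => b1 ?_ h
    rw [inner_add_left, inner_smul_left, inner_normal, inner_smul_left (r⁻¹ • d), Real.sin_neg]
    simp only [conj_trivial]
    nlinarith

end

/-! ### Global convexity -/

lemma add_mem_cone_of_segment {Ω : Set S2} {x y : E3} (h : segment ℝ x y ⊆ cone Ω) {α β : ℝ}
    (hα : 0 ≤ α) (hβ : 0 ≤ β) (hαβ : 0 < α + β) : α • x + β • y ∈ cone Ω := by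
  have hm : (α / (α + β)) • x + (β / (α + β)) • y ∈ cone Ω :=
    h ⟨_, _, by positivity, by positivity, by rw [← add_div, div_self hαβ.ne'], rfl⟩
  have := smul_mem_cone hm hαβ
  rwa [smul_add, smul_smul, smul_smul, mul_div_cancel₀ _ hαβ.ne', mul_div_cancel₀ _ hαβ.ne'] at this

/-- The tube lemma for the compact parameter interval. It gives openness in both continuity
arguments below. -/
lemma isOpen_forall_mem_Icc {X : Type*} [TopologicalSpace X] {C : Set E3} (hC : IsOpen C)
    {f : X × ℝ → E3} (hf : Continuous f) (a b : ℝ) :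
    IsOpen {y | ∀ s ∈ Set.Icc a b, f (y, s) ∈ C} := by
  rw [isOpen_iff_mem_nhds]
  intro y hy
  refine isCompact_Icc.eventually_forall_of_forall_eventually fun s hs => ?_
  exact hf.continuousAt.eventually_mem (hC.mem_nhds (hy s hs))

section

variable {γ : ℝ → E3} (hγ : IsSmoothSimpleClosed γ) {Ω : Set S2} (hΩ : IsEnclosedRegion γ Ω)
  (hk : ∀ u, 0 < geodesicCurvature γ u)
include hγ hΩ hk

/-- At a boundary point `z` of the segment, the tangency lemma makes `y - x` a multiple of `z`. Then
`x` and `y` are multiples of `z`, one of them positive, which would put `z` in the cone. -/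
lemma segment_subset_cone {x y : E3} (hx : x ∈ cone Ω) (hy : y ∈ cone Ω)
    (h : segment ℝ x y ⊆ closure (cone Ω)) (h0 : (0 : E3) ∉ segment ℝ x y) :
    segment ℝ x y ⊆ cone Ω := by
  have hC := isOpen_cone hΩ.isOpen
  intro z hz
  by_contra hzC
  have hz0 : z ≠ 0 := fun h => h0 (h ▸ hz)
  have hzf : z ∈ frontier (cone Ω) := ⟨h hz, by rwa [hC.interior_eq]⟩
  rw [segment_eq_image] at hz
  obtain ⟨s, hs, rfl⟩ := hz
  have hs0 : s ≠ 0 := by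
    rintro rfl
    simp only [sub_zero, one_smul, zero_smul, add_zero] at hzC
    exact hzC hx
  have hs1 : s ≠ 1 := by
    rintro rfl
    simp only [sub_self, one_smul, zero_smul, zero_add] at hzC
    exact hzC hy
  have hs0' : 0 < s := lt_of_le_of_ne hs.1 hs0.symm
  have hs1' : s < 1 := lt_of_le_of_ne hs.2 hs1
  set z := (1 - s) • x + s • y with hzdef
  obtain ⟨c, hc⟩ := exists_smul_of_tangent hγ hΩ hk (d := y - x) hzf hz0 (by
    have h1 : ∀ᶠ τ in 𝓝 (0 : ℝ), 0 < Real.cos τ :=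
      Real.continuous_cos.continuousAt.eventually_const_lt (by simp)
    -- Up to the positive factor `cos τ`, the circular path of the tangency lemma is the segment at
    -- parameter `s + tan τ`.
    have h2 : ∀ᶠ τ in 𝓝 (0 : ℝ), s + Real.tan τ ∈ Set.Ioo (0 : ℝ) 1 := by
      have : ContinuousAt (fun τ => s + Real.tan τ) 0 :=
        continuousAt_const.add (Real.continuousAt_tan.2 (by simp))
      exact this.eventually_mem (isOpen_Ioo.mem_nhds (by simp [hs0', hs1']))
    filter_upwards [h1, h2] with τ h1 h2
    have h3 : Real.cos τ • z + Real.sin τ • (y - x) =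
        Real.cos τ • ((1 - (s + Real.tan τ)) • x + (s + Real.tan τ) • y) := by
      rw [Real.tan_eq_sin_div_cos, hzdef]
      have : Real.sin τ = Real.cos τ * (Real.sin τ / Real.cos τ) := by field_simp
      rw [this]
      simp only [mul_div_cancel_left₀ _ h1.ne']
      module
    rw [h3]
    exact smul_mem_closure_cone (h ⟨_, _, by linarith [h2.2], h2.1.le, by ring, rfl⟩) h1)
  have hxz : x = (1 - s * c) • z := by
    have : x = z - s • (y - x) := by rw [hzdef]; module
    rw [hc] at this
    rw [sub_smul, one_smul, mul_smul]
    exact this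
  have hyz : y = (1 + (1 - s) * c) • z := by
    have : y = z + (1 - s) • (y - x) := by rw [hzdef]; module
    rw [hc] at this
    rw [add_smul, one_smul, mul_smul]
    exact this
  have key : ∀ {p : E3} {α : ℝ}, p ∈ cone Ω → p = α • z → 0 < α → False := by
    intro p α hp hpz hα
    refine hzC ?_
    have := smul_mem_cone hp (inv_pos.2 hα)
    rwa [hpz, smul_smul, inv_mul_cancel₀ hα.ne', one_smul] at this
  rcases lt_or_ge 0 (1 - s * c) with h1 | h1
  · exact key hx hxz h1
  · refine key hy hyz ?_
    have : 0 < c := by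
      by_contra hc0
      nlinarith [mul_nonneg hs0'.le (neg_nonneg.2 (not_lt.1 hc0))]
    nlinarith [mul_pos (sub_pos.2 hs1') this]

/-- The cone over `Ω` contains no half-plane bounded by a line through the origin. -/
lemma not_halfPlane_subset_cone {x w : E3} (hx : ⟪x, x⟫ = 1) (hw : ⟪w, w⟫ = 1) (hxw : ⟪x, w⟫ = 0)
    (h : ∀ φ ∈ Set.Icc 0 Real.pi, Real.cos φ • x + Real.sin φ • w ∈ cone Ω) : False := by
  have hC := isOpen_cone hΩ.isOpen
  have hx1 : x ∈ cone Ω := by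
    have := h 0 ⟨le_rfl, Real.pi_pos.le⟩
    simpa using this
  have hx2 : -x ∈ cone Ω := by
    have := h Real.pi ⟨Real.pi_pos.le, le_rfl⟩
    simpa using this
  let w' := cross x w
  let W : ℝ → E3 := fun θ => Real.cos θ • w + Real.sin θ • w'
  have hw'w' : ⟪w', w'⟫ = 1 := inner_cross_self_of_orthonormal hx hw hxw
  have hxw' : ⟪x, w'⟫ = 0 := inner_cross_self_left x w
  have hww' : ⟪w, w'⟫ = 0 := inner_cross_self_right x w
  have hWW : ∀ θ, ⟪W θ, W θ⟫ = 1 := fun θ => by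
    simp only [W, inner_add_left, inner_add_right, inner_smul_left, inner_smul_right, hw, hw'w',
      hww', real_inner_comm w w', conj_trivial]
    linarith [Real.sin_sq_add_cos_sq θ]
  have hxW : ∀ θ, ⟪x, W θ⟫ = 0 := fun θ => by
    simp only [W, inner_add_right, inner_smul_right, hxw, hxw']
    ring
  have hcont : Continuous fun p : ℝ × ℝ => Real.cos p.2 • x + Real.sin p.2 • W p.1 := by
    simp only [W]
    fun_prop
  -- Rotate the half-plane about the axis `x`. The admissible angles form a clopen set: a limiting
  -- half-circle has its endpoints `±x` in the open cone, and its velocity at an interior contact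
  -- would be a unit vector both orthogonal and parallel to the contact point.
  let Θ : Set ℝ := {θ | ∀ φ ∈ Set.Icc 0 Real.pi, Real.cos φ • x + Real.sin φ • W θ ∈ cone Ω}
  have hΘo : IsOpen Θ := isOpen_forall_mem_Icc hC hcont 0 Real.pi
  have hΘc : IsClosed Θ := by
    refine isClosed_of_closure_subset fun θ hθ => ?_
    have hcl : ∀ φ ∈ Set.Icc 0 Real.pi, Real.cos φ • x + Real.sin φ • W θ ∈ closure (cone Ω) :=
      fun φ hφ => by
        have hcφ : Continuous fun θ => Real.cos φ • x + Real.sin φ • W θ := by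
          simp only [W]
          fun_prop
        have hmaps : Set.MapsTo (fun θ => Real.cos φ • x + Real.sin φ • W θ) Θ (cone Ω) :=
          fun θ' hθ' => hθ' φ hφ
        exact hmaps.closure hcφ hθ
    intro φ hφ
    rcases eq_or_lt_of_le hφ.1 with rfl | hφ0
    · simpa using hx1
    rcases eq_or_lt_of_le hφ.2 with rfl | hφ1
    · simpa using hx2
    by_contra hz
    set z := Real.cos φ • x + Real.sin φ • W θ with hzdef
    set d := -Real.sin φ • x + Real.cos φ • W θ with hddef
    have hzz : ⟪z, z⟫ = 1 := by
      simp only [hzdef, inner_add_left, inner_add_right, inner_smul_left, inner_smul_right, hx,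
        hWW, hxW, real_inner_comm x (W θ), conj_trivial]
      linarith [Real.sin_sq_add_cos_sq φ]
    have hdd : ⟪d, d⟫ = 1 := by
      simp only [hddef, inner_add_left, inner_add_right, inner_smul_left, inner_smul_right, hx,
        hWW, hxW, real_inner_comm x (W θ), conj_trivial]
      linarith [Real.sin_sq_add_cos_sq φ]
    have hdz : ⟪d, z⟫ = 0 := by
      simp only [hddef, hzdef, inner_add_left, inner_add_right, inner_smul_left, inner_smul_right,
        hx, hWW, hxW, real_inner_comm x (W θ), conj_trivial]
      ring
    have hz0 : z ≠ 0 := fun h => by simp [h] at hzz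
    obtain ⟨c, hc⟩ := exists_smul_of_tangent hγ hΩ hk (d := d)
      ⟨hcl φ hφ, by rwa [hC.interior_eq]⟩ hz0 (by
      have h1 : ∀ᶠ τ in 𝓝 (0 : ℝ), φ + τ ∈ Set.Ioo 0 Real.pi :=
        (continuous_const.add continuous_id).continuousAt.eventually_mem
          (isOpen_Ioo.mem_nhds (by simp [hφ0, hφ1]))
      filter_upwards [h1] with τ hτ
      have := hcl (φ + τ) (Set.Ioo_subset_Icc_self hτ)
      rw [Real.cos_add, Real.sin_add] at this
      convert this using 1
      rw [hddef]
      module)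
    have hc0 : c = 0 := by
      rw [hc, inner_smul_left, hzz] at hdz
      simpa using hdz
    rw [hc, hc0] at hdd
    simp at hdd
  have h0 : (0 : ℝ) ∈ Θ := by
    intro φ hφ
    simpa [W] using h φ hφ
  have huniv : Θ = Set.univ := IsClopen.eq_univ ⟨hΘc, hΘo⟩ ⟨0, h0⟩
  -- every point of the sphere lies on one of the rotated half circles
  have hexp := frame_expansion hx hw hxw (γ 0)
  have hsq := inner_self_expansion hx hw hxw (γ 0)
  rw [hγ.inner_self] at hsq
  set p := ⟪γ 0, x⟫
  set q := ⟪γ 0, w⟫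
  set s := ⟪γ 0, cross x w⟫
  let ζ : ℂ := ⟨q, s⟩
  have hζ1 : ‖ζ‖ * Real.cos ζ.arg = q := Complex.norm_mul_cos_arg ζ
  have hζ2 : ‖ζ‖ * Real.sin ζ.arg = s := Complex.norm_mul_sin_arg ζ
  have hζ3 : ‖ζ‖ ^ 2 = q ^ 2 + s ^ 2 := by
    rw [← Complex.normSq_eq_norm_sq, Complex.normSq_apply]
    ring
  have hp : -1 ≤ p ∧ p ≤ 1 :=
    abs_le_of_sq_le_sq' (by nlinarith [sq_nonneg q, sq_nonneg s]) zero_le_one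
  have hsin : Real.sin (Real.arccos p) = ‖ζ‖ := by
    rw [Real.sin_arccos, show 1 - p ^ 2 = ‖ζ‖ ^ 2 by linarith, Real.sqrt_sq (norm_nonneg _)]
  have hmem : ζ.arg ∈ Θ := huniv ▸ Set.mem_univ _
  have := hmem (Real.arccos p) ⟨Real.arccos_nonneg p, Real.arccos_le_pi p⟩
  rw [Real.cos_arccos hp.1 hp.2, hsin] at this
  refine notMem_cone hγ hΩ 0 ?_
  convert this using 1
  rw [hexp]
  simp only [W, w', smul_add, smul_smul, hζ1, hζ2]
  abel

/-- The cone over the region enclosed by a strictly convex curve is convex. -/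
theorem convex_cone : Convex ℝ (cone Ω) := by
  have hC := isOpen_cone hΩ.isOpen
  have hzero := zero_notMem_cone Ω
  -- it suffices to see every point from the points of the unit sphere
  suffices H : ∀ x ∈ cone Ω, ⟪x, x⟫ = 1 → ∀ y ∈ cone Ω, segment ℝ x y ⊆ cone Ω by
    rw [convex_iff_segment_subset]
    intro x hx y hy
    have hx0 : x ≠ 0 := fun h => hzero (h ▸ hx)
    have hn : 0 < ‖x‖ := norm_pos_iff.2 hx0
    have h1 := H (‖x‖⁻¹ • x) (smul_mem_cone hx (inv_pos.2 hn)) (by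
      rw [inner_smul_left, inner_smul_right, real_inner_self_eq_norm_sq]
      simp only [conj_trivial]
      field_simp) y hy
    rintro _ ⟨a, b, ha, hb, hab, rfl⟩
    have := add_mem_cone_of_segment h1 (α := a * ‖x‖) (β := b) (by positivity) hb (by
      rcases eq_or_lt_of_le hb with rfl | hb'
      · have : a = 1 := by linarith
        rw [this]
        linarith
      · positivity)
    rwa [smul_smul, mul_assoc, mul_inv_cancel₀ hn.ne', mul_one] at this
  intro x hx hxx
  -- `V` is the set of points visible from `x`. It is open, so by connectedness of the cone it
  -- suffices that it is relatively closed there.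
  let V : Set E3 := {y | ∀ s ∈ Set.Icc (0 : ℝ) 1, (1 - s) • x + s • y ∈ cone Ω}
  have hVseg : ∀ {y}, y ∈ V ↔ segment ℝ x y ⊆ cone Ω := fun {y} => by
    rw [segment_eq_image, Set.image_subset_iff]
    rfl
  have hVo : IsOpen V := isOpen_forall_mem_Icc (f := fun p => (1 - p.2) • x + p.2 • p.1) hC
    (by fun_prop) 0 1
  have hxV : x ∈ V := hVseg.2 (by rw [segment_same]; simpa using hx)
  suffices hsub : cone Ω ⊆ V from fun y hy => hVseg.1 (hsub hy)
  refine (isConnected_cone hΩ.isConnected).isPreconnected.subset_of_closure_inter_subset hVo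
    ⟨x, hx, hxV⟩ ?_
  rintro y ⟨hyV, hy⟩
  have hcl : segment ℝ x y ⊆ closure (cone Ω) := by
    rw [segment_eq_image]
    rintro _ ⟨s, hs, rfl⟩
    exact map_mem_closure (f := fun y => (1 - s) • x + s • y) (by fun_prop) hyV fun y' hy' =>
      hy' s hs
  by_cases h0 : (0 : E3) ∈ segment ℝ x y
  swap
  · exact hVseg.2 (segment_subset_cone hγ hΩ hk hx hy hcl h0)
  -- the antipodal case
  exfalso
  obtain ⟨a, b, ha, hb, hab, h0⟩ := h0
  have hb0 : 0 < b := by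
    refine lt_of_le_of_ne hb ?_
    rintro rfl
    have : a = 1 := by linarith
    rw [this] at h0
    simp only [one_smul, zero_smul, add_zero] at h0
    exact hzero (h0 ▸ hx)
  have ha0 : 0 < a := by
    refine lt_of_le_of_ne ha ?_
    rintro rfl
    have : b = 1 := by linarith
    rw [this] at h0
    simp only [one_smul, zero_smul, zero_add] at h0
    exact hzero (h0 ▸ hy)
  have hyx : y = -(a / b) • x := by
    have : b • y = -(a • x) := by rw [eq_neg_iff_add_eq_zero, add_comm]; exact h0
    rw [neg_smul, div_eq_inv_mul, mul_smul, ← smul_neg, ← this, smul_smul, inv_mul_cancel₀ hb0.ne',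
      one_smul]
  set l := a / b
  have hl : 0 < l := div_pos ha0 hb0
  obtain ⟨ρ, hρ, hball⟩ := Metric.isOpen_iff.1 hC y hy
  have hneg : {p : E3 | ⟪p, x⟫ < 0} ∈ 𝓝 y := by
    refine (isOpen_lt (by fun_prop) continuous_const).mem_nhds ?_
    rw [Set.mem_ofPred_eq, hyx, inner_smul_left, hxx]
    simpa using hl
  -- A visible point `y'` near `y`, with `⟨y', x⟩ < 0`, replaces the degenerate segment by two: the
  -- sectors over `[x, y']` and `[y', y]` together fill a half-plane bounded by the line through
  -- `x`.
  obtain ⟨y', ⟨hy'b, hy'n⟩, hy'V⟩ := mem_closure_iff_nhds.1 hyV _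
    (Filter.inter_mem (Metric.ball_mem_nhds y hρ) hneg)
  have hy'n : ⟪y', x⟫ < 0 := hy'n
  have hseg1 := hVseg.1 hy'V
  have hseg2 : segment ℝ y' y ⊆ cone Ω :=
    ((convex_ball y ρ).segment_subset hy'b (Metric.mem_ball_self hρ)).trans hball
  set w₀ := y' - ⟪y', x⟫ • x with hw₀
  have hw₀x : ⟪x, w₀⟫ = 0 := by
    rw [hw₀, inner_sub_right, inner_smul_right, hxx, real_inner_comm]
    ring
  have hw₀0 : w₀ ≠ 0 := by
    intro h
    have hyx' : y' = ⟪y', x⟫ • x := sub_eq_zero.1 h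
    have := add_mem_cone_of_segment hseg1 (α := -⟪y', x⟫) (β := 1) (by linarith) zero_le_one
      (by linarith)
    rw [one_smul, neg_smul, ← hyx', neg_add_cancel] at this
    exact hzero this
  have hn : 0 < ‖w₀‖ := norm_pos_iff.2 hw₀0
  refine not_halfPlane_subset_cone hγ hΩ hk (x := x) (w := ‖w₀‖⁻¹ • w₀) hxx ?_ ?_ ?_
  · rw [inner_smul_left, inner_smul_right, real_inner_self_eq_norm_sq]
    simp only [conj_trivial]
    field_simp
  · rw [inner_smul_right, hw₀x, mul_zero]
  intro φ hφ
  have hs : 0 ≤ Real.sin φ := Real.sin_nonneg_of_nonneg_of_le_pi hφ.1 hφ.2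
  set σ := Real.sin φ * ‖w₀‖⁻¹ with hσ
  have hσ0 : 0 ≤ σ := by positivity
  set m := Real.cos φ - σ * ⟪y', x⟫ with hm
  have e1 : Real.cos φ • x + Real.sin φ • ‖w₀‖⁻¹ • w₀ = m • x + σ • y' := by
    rw [smul_smul, ← hσ, hw₀, hm]
    module
  have hne : σ = 0 → m ≠ 0 := by
    intro h1 h2
    rw [hm, h1, zero_mul, sub_zero] at h2
    have h3 : Real.sin φ = 0 := by
      rcases mul_eq_zero.1 h1 with h | h
      · exact h
      · exact absurd h (inv_pos.2 hn).ne'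
    have := Real.sin_sq_add_cos_sq φ
    rw [h2, h3] at this
    norm_num at this
  rw [e1]
  -- The sign of `m` decides the sector; for `m < 0`, `m x` is the positive multiple `(-m/l) y`.
  rcases le_or_gt 0 m with hm0 | hm0
  · refine add_mem_cone_of_segment hseg1 hm0 hσ0 ?_
    rcases eq_or_lt_of_le hσ0 with h | h
    · have := lt_of_le_of_ne hm0 (hne h.symm).symm
      linarith
    · linarith
  · have e2 : m • x + σ • y' = σ • y' + (-m / l) • y := by
      rw [hyx, smul_smul, add_comm]
      congr 2
      field_simp
    rw [e2]
    have : 0 < -m / l := div_pos (neg_pos.2 hm0) hl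
    exact add_mem_cone_of_segment hseg2 hσ0 this.le (by linarith)

/-! ### Supporting planes -/

/-- Convexity turns the local statement into a global one: a point `y` beyond the tangent plane
would give points of the closed cone beyond it arbitrarily near `γ u`, on the segment to `y`. -/
lemma inner_normal_nonneg_of_mem_closure {y : E3} (hy : y ∈ closure (cone Ω)) (u : ℝ) :
    0 ≤ ⟪y, normal γ u⟫ := by
  by_contra hneg
  rw [not_le] at hneg
  have hc : Continuous fun s : ℝ => (1 - s) • γ u + s • y := by fun_prop
  have ht := hc.tendsto 0
  simp only [sub_zero, one_smul, zero_smul, add_zero] at ht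
  obtain ⟨s, h1, h2⟩ := (((ht.eventually (eventually_outside hγ hΩ hk u)).filter_mono
    (nhdsWithin_le_nhds (s := Set.Ioi 0))).and (Ioo_mem_nhdsGT one_pos)).exists
  have e : ⟪(1 - s) • γ u + s • y, normal γ u⟫ = s * ⟪y, normal γ u⟫ := by
    rw [inner_add_left, inner_smul_left, inner_smul_left, inner_normal]
    simp
  have hlt : s * ⟪y, normal γ u⟫ < 0 := mul_neg_of_pos_of_neg h2.1 hneg
  obtain ⟨r, hr⟩ := h1 (by rw [e]; exact hlt.le)
    ((convex_cone hγ hΩ hk).closure (mem_frontier_cone hγ hΩ u).1 hy (by linarith [h2.2]) h2.1.le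
      (by ring))
  rw [hr, inner_smul_left, inner_normal, mul_zero] at e
  linarith

lemma inner_normal_pos_of_mem {y : E3} (hy : y ∈ cone Ω) (u : ℝ) : 0 < ⟪y, normal γ u⟫ := by
  have hc : Continuous fun ε : ℝ => y - ε • normal γ u := by fun_prop
  have ht := hc.tendsto 0
  simp only [zero_smul, sub_zero] at ht
  obtain ⟨ε, h1, h2⟩ := (((ht.eventually_mem ((isOpen_cone hΩ.isOpen).mem_nhds hy)).filter_mono
    (nhdsWithin_le_nhds (s := Set.Ioi 0))).and (Ioo_mem_nhdsGT one_pos)).exists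
  have h3 := inner_normal_nonneg_of_mem_closure hγ hΩ hk (subset_closure h1) u
  rw [inner_sub_left, inner_smul_left, hγ.inner_normal_self] at h3
  simp only [conj_trivial, mul_one] at h3
  linarith [h2.1]

/-- The intersection of the open half-spaces is convex, hence connected, and it misses the frontier
since `⟨γ u, η u⟩ = 0`. As it contains the cone, it cannot lie outside. -/
lemma cone_eq : cone Ω = {x | ∀ u, 0 < ⟪x, normal γ u⟫} := by
  apply Set.Subset.antisymm
  · exact fun x hx u => inner_normal_pos_of_mem hγ hΩ hk hx u
  have hconv : Convex ℝ {x : E3 | ∀ u, 0 < ⟪x, normal γ u⟫} := by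
    intro x hx y hy a b ha hb hab u
    rw [inner_add_left, inner_smul_left, inner_smul_left]
    simp only [conj_trivial]
    have h1 := hx u
    have h2 := hy u
    rcases eq_or_lt_of_le ha with rfl | ha
    · have : b = 1 := by linarith
      rw [this]; linarith
    · have := mul_pos ha h1
      have := mul_nonneg hb h2.le
      linarith
  have hdisj : Disjoint {x : E3 | ∀ u, 0 < ⟪x, normal γ u⟫} (frontier (cone Ω)) := by
    rw [Set.disjoint_left]
    intro x hx hxf
    have hx0 : x ≠ 0 := by
      rintro rfl
      simpa using hx 0
    obtain ⟨u, r, -, rfl⟩ := exists_of_mem_frontier_cone hΩ hxf hx0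
    have := hx u
    rw [inner_smul_left, inner_normal, mul_zero] at this
    exact lt_irrefl _ this
  refine (subset_or_disjoint_closure hconv.isPreconnected (isOpen_cone hΩ.isOpen)
    hdisj).resolve_right fun h => ?_
  obtain ⟨x, hx⟩ := (isConnected_cone hΩ.isConnected).nonempty
  exact Set.disjoint_left.1 h (fun u => inner_normal_pos_of_mem hγ hΩ hk hx u) (subset_closure hx)

/-- Otherwise the segment from `γ u` to `γ v` would lie in the tangent plane and in the closed cone;
local strictness near `γ u` forces `γ v = ±γ u`. -/
lemma eq_of_inner_normal_eq_zero {u v : ℝ} (h : ⟪γ v, normal γ u⟫ = 0) : γ v = γ u := by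
  have hnn : ∀ v u, 0 ≤ ⟪γ v, normal γ u⟫ := fun v u =>
    inner_normal_nonneg_of_mem_closure hγ hΩ hk (mem_frontier_cone hγ hΩ v).1 u
  have hc : Continuous fun s : ℝ => (1 - s) • γ u + s • γ v := by fun_prop
  have ht := hc.tendsto 0
  simp only [sub_zero, one_smul, zero_smul, add_zero] at ht
  obtain ⟨s, h1, h2⟩ := (((ht.eventually (eventually_outside hγ hΩ hk u)).filter_mono
    (nhdsWithin_le_nhds (s := Set.Ioi 0))).and (Ioo_mem_nhdsGT one_pos)).exists
  have e : ⟪(1 - s) • γ u + s • γ v, normal γ u⟫ = 0 := by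
    rw [inner_add_left, inner_smul_left, inner_smul_left, inner_normal, h]
    simp
  obtain ⟨r, hr⟩ := h1 e.le
    ((convex_cone hγ hΩ hk).closure (mem_frontier_cone hγ hΩ u).1 (mem_frontier_cone hγ hΩ v).1
      (by linarith [h2.2]) h2.1.le (by ring))
  obtain ⟨c, hvc⟩ : ∃ c : ℝ, γ v = c • γ u := by
    refine ⟨s⁻¹ * (r - (1 - s)), ?_⟩
    have : s • γ v = (r - (1 - s)) • γ u := by rw [sub_smul, ← hr]; abel
    rw [mul_smul, ← this, smul_smul, inv_mul_cancel₀ h2.1.ne', one_smul]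
  have hc2 : c ^ 2 = 1 := by
    have := hγ.inner_self v
    rw [hvc, inner_smul_left, inner_smul_right, hγ.inner_self] at this
    simp only [conj_trivial] at this
    linarith
  rcases sq_eq_one_iff.1 hc2 with rfl | rfl
  · rw [hvc, one_smul]
  -- `γ v = -γ u` would confine `γ u` to all tangent planes
  exfalso
  have hz : ∀ u', ⟪γ u, normal γ u'⟫ = 0 := fun u' => by
    have h3 := hnn v u'
    rw [hvc, inner_smul_left] at h3
    simp only [conj_trivial] at h3
    linarith [hnn u u']
  have hz2 : ∀ u', ⟪γ u, tangent γ u'⟫ = 0 := fun u' => by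
    have h4 := (hasDerivAt_const u' (γ u)).inner ℝ (hγ.hasDerivAt_normal u')
    simp only [hz, inner_zero_left, add_zero, inner_smul_right] at h4
    have h5 := h4.unique (hasDerivAt_const _ _)
    exact (mul_eq_zero.1 h5).resolve_left
      (neg_ne_zero.2 (mul_pos (hγ.speed_pos u') (hk u')).ne')
  have h4 := (hasDerivAt_const u (γ u)).inner ℝ (hγ.hasDerivAt_tangent u)
  simp only [hz2, inner_zero_left, add_zero, inner_smul_right, inner_add_right, inner_neg_right,
    hγ.inner_self, hz, mul_zero] at h4
  have h5 := h4.unique (hasDerivAt_const _ _)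
  have := hγ.speed_pos u
  linarith

end

open MeasureTheory

/-! ### The tangent developable covers the exterior once -/

/-- The parametrization of the tangent half-planes of the cone over `γ`. -/
def tangentMap (γ : ℝ → E3) (p : E3) : E3 := p 1 • γ (p 0) + p 2 • tangent γ (p 0)

/-- The tangent half-disks of the unit ball. -/
def tangentDomain : Set E3 :=
  {p | p 0 ∈ Set.Ico 0 (2 * Real.pi) ∧ 0 < p 2 ∧ p 1 ^ 2 + p 2 ^ 2 < 1}

section

variable {γ : ℝ → E3} (hγ : IsSmoothSimpleClosed γ)
include hγ

lemma inner_tangentMap_self (p : E3) : ⟪tangentMap γ p, γ (p 0)⟫ = p 1 := by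
  rw [tangentMap, inner_add_left, inner_smul_left, inner_smul_left, hγ.inner_self,
    real_inner_comm, hγ.inner_tangent]
  simp

lemma inner_tangentMap_tangent (p : E3) : ⟪tangentMap γ p, tangent γ (p 0)⟫ = p 2 := by
  rw [tangentMap, inner_add_left, inner_smul_left, inner_smul_left, hγ.inner_tangent_self,
    hγ.inner_tangent]
  simp

omit hγ in
lemma inner_tangentMap_normal (p : E3) : ⟪tangentMap γ p, normal γ (p 0)⟫ = 0 := by
  rw [tangentMap, inner_add_left, inner_smul_left, inner_smul_left, inner_normal,
    inner_tangent_normal]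
  simp

omit hγ in
lemma cross_tangentMap (p : E3) : cross (γ (p 0)) (tangentMap γ p) = p 2 • normal γ (p 0) := by
  rw [tangentMap, ← crossL_apply, map_add, map_smul, map_smul, crossL_apply, crossL_apply,
    cross_self_eq_zero, smul_zero, zero_add, normal]

lemma norm_tangentMap_sq (p : E3) : ‖tangentMap γ p‖ ^ 2 = p 1 ^ 2 + p 2 ^ 2 := by
  have h := inner_self_expansion (hγ.inner_self (p 0)) (hγ.inner_tangent_self (p 0))
    (hγ.inner_tangent (p 0)) (tangentMap γ p)
  rw [← normal, inner_tangentMap_self hγ, inner_tangentMap_tangent hγ, inner_tangentMap_normal,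
    real_inner_self_eq_norm_sq] at h
  linarith

/-- The derivative of `tangentMap`. -/
def tangentMapDeriv (γ : ℝ → E3) (p : E3) : E3 →L[ℝ] E3 :=
  (EuclideanSpace.proj (𝕜 := ℝ) (0 : Fin 3)).smulRight
      (p 1 • speed γ (p 0) • tangent γ (p 0) +
        p 2 • speed γ (p 0) • (-γ (p 0) + geodesicCurvature γ (p 0) • normal γ (p 0))) +
    (EuclideanSpace.proj (𝕜 := ℝ) (1 : Fin 3)).smulRight (γ (p 0)) +
    (EuclideanSpace.proj (𝕜 := ℝ) (2 : Fin 3)).smulRight (tangent γ (p 0))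

lemma hasFDerivAt_tangentMap (p : E3) : HasFDerivAt (tangentMap γ) (tangentMapDeriv γ p) p := by
  have hp : ∀ i : Fin 3, HasFDerivAt (fun p : E3 => p i) (EuclideanSpace.proj (𝕜 := ℝ) i) p :=
    fun i => (EuclideanSpace.proj (𝕜 := ℝ) i).hasFDerivAt
  have h1 := (hp 1).fun_smul ((hγ.hasDerivAt (p 0)).hasFDerivAt.comp p (hp 0))
  have h2 := (hp 2).fun_smul ((hγ.hasDerivAt_tangent (p 0)).hasFDerivAt.comp p (hp 0))
  refine (h1.add h2).congr_fderiv ?_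
  ext1 v
  simp [tangentMapDeriv]
  module

/-- Only the `η` component of the derivative in `p 0` survives, so the Jacobian does not involve `p
1`. -/
lemma det_tangentMapDeriv (p : E3) :
    (tangentMapDeriv γ p).det = p 2 * (geodesicCurvature γ (p 0) * speed γ (p 0)) := by
  have e1 : tangentMapDeriv γ p (EuclideanSpace.single 1 1) = γ (p 0) := by
    simp [tangentMapDeriv]
  have e2 : tangentMapDeriv γ p (EuclideanSpace.single 2 1) = tangent γ (p 0) := by
    simp [tangentMapDeriv]
  have e0 : tangentMapDeriv γ p (EuclideanSpace.single 0 1) =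
      p 1 • speed γ (p 0) • tangent γ (p 0) +
        p 2 • speed γ (p 0) • (-γ (p 0) + geodesicCurvature γ (p 0) • normal γ (p 0)) := by
    simp [tangentMapDeriv]
  rw [det_eq_triple_product, e0, e1, e2, ← normal]
  simp only [inner_add_left, inner_smul_left, inner_neg_left, inner_normal, inner_tangent_normal,
    hγ.inner_normal_self, conj_trivial]
  ring

variable {Ω : Set S2} (hΩ : IsEnclosedRegion γ Ω) (hk : ∀ u, 0 < geodesicCurvature γ u)
include hΩ hk

/-- For a common image `x`, the triple product of `γ (p 0)`, `γ (q 0)` and `x` computed in two ways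
gives `p 2 ⟨γ (q 0), η (p 0)⟩ = -q 2 ⟨γ (p 0), η (q 0)⟩`. Both inner products are nonnegative, so
both sides vanish and the two tangency rays agree. -/
lemma injOn_tangentMap : Set.InjOn (tangentMap γ) tangentDomain := by
  rintro p ⟨hp0, hp2, -⟩ q ⟨hq0, hq2, -⟩ h
  have hnn : ∀ v u, 0 ≤ ⟪γ v, normal γ u⟫ := fun v u =>
    inner_normal_nonneg_of_mem_closure hγ hΩ hk (mem_frontier_cone hγ hΩ v).1 u
  have h1 := inner_cross_swap (γ (p 0)) (tangentMap γ p) (γ (q 0))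
  rw [cross_tangentMap, h, cross_tangentMap, inner_smul_right, inner_smul_right] at h1
  have h2 := mul_nonneg hp2.le (hnn (q 0) (p 0))
  have h3 := mul_nonneg hq2.le (hnn (p 0) (q 0))
  have h4 : p 2 * ⟪γ (q 0), normal γ (p 0)⟫ = 0 := by linarith
  have h5 := eq_of_inner_normal_eq_zero hγ hΩ hk ((mul_eq_zero.1 h4).resolve_left hp2.ne')
  have h6 : q 0 = p 0 := hγ.simple hq0 hp0 h5
  apply ext_coord h6.symm
  · rw [← inner_tangentMap_self hγ p, ← inner_tangentMap_self hγ q, h, h6]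
  · rw [← inner_tangentMap_tangent hγ p, ← inner_tangentMap_tangent hγ q, h, h6]

/-- A point outside the double cone lies on a tangent half-plane. -/
lemma exists_inner_normal_eq_zero {x : E3} (h1 : x ∉ cone Ω) (h2 : -x ∉ cone Ω)
    (h3 : ∀ u, ∀ r : ℝ, x ≠ r • γ u) : ∃ u, ⟪x, normal γ u⟫ = 0 ∧ 0 < ⟪x, tangent γ u⟫ := by
  let g : ℝ → ℝ := fun u => ⟪x, normal γ u⟫
  have hd : ∀ u, HasDerivAt g (-(speed γ u * geodesicCurvature γ u) * ⟪x, tangent γ u⟫) u :=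
    fun u => by
      have h := (hasDerivAt_const u x).inner ℝ (hγ.hasDerivAt_normal u)
      simpa [g, inner_smul_right] using h
  have hcont : Continuous g := continuous_const.inner hγ.continuous_normal
  have hpos : ∀ u, 0 < speed γ u * geodesicCurvature γ u := fun u =>
    mul_pos (hγ.speed_pos u) (hk u)
  -- A common zero of `⟨x, η⟩` and `⟨x, t⟩` would put `x` on the line of `γ u`. Hence zeros of `g`
  -- are simple, and its extrema are nonzero.
  have hns : ∀ u, g u = 0 → ⟪x, tangent γ u⟫ ≠ 0 := fun u hg ht => h3 u _
    (eq_smul_of_orthogonal (hγ.inner_self u) (hγ.inner_tangent_self u) (hγ.inner_tangent u) ht hg)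
  have hper : Function.Periodic g (2 * Real.pi) := fun u => by
    simp only [g, hγ.periodic_normal u]
  rw [cone_eq hγ hΩ hk, Set.mem_ofPred_eq] at h1 h2
  push Not at h1 h2
  obtain ⟨u₁, hu₁⟩ := h1
  obtain ⟨u₂, hu₂⟩ := h2
  rw [inner_neg_left, neg_nonpos] at hu₂
  have hred : ∀ u, ∃ v ∈ Set.Icc 0 (2 * Real.pi), g u = g v := fun u => by
    obtain ⟨v, hv, n, rfl⟩ := exists_mem_Ico_eq u
    exact ⟨v, Set.Ico_subset_Icc_self hv, hper.zsmul n v⟩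
  have hne' : (Set.Icc 0 (2 * Real.pi)).Nonempty := Set.nonempty_Icc.2 Real.two_pi_pos.le
  obtain ⟨m, hm, hmin⟩ := isCompact_Icc.exists_isMinOn hne' hcont.continuousOn
  obtain ⟨M, hM, hmax⟩ := isCompact_Icc.exists_isMaxOn hne' hcont.continuousOn
  have hmin' : ∀ u, g m ≤ g u := fun u => by
    obtain ⟨v, hv, e⟩ := hred u
    rw [e]
    exact hmin hv
  have hmax' : ∀ u, g u ≤ g M := fun u => by
    obtain ⟨v, hv, e⟩ := hred u
    rw [e]
    exact hmax hv
  have hcrit : ∀ u, -(speed γ u * geodesicCurvature γ u) * ⟪x, tangent γ u⟫ = 0 → g u ≠ 0 :=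
    fun u hu hg => hns u hg ((mul_eq_zero.1 hu).resolve_left (neg_ne_zero.2 (hpos u).ne'))
  have hgm : g m < 0 := lt_of_le_of_ne ((hmin' u₁).trans hu₁)
    (hcrit m (IsLocalMin.hasDerivAt_eq_zero (Filter.Eventually.of_forall hmin') (hd m)))
  have hgM : 0 < g M := lt_of_le_of_ne (hu₂.trans (hmax' u₂))
    (hcrit M (IsLocalMax.hasDerivAt_eq_zero (Filter.Eventually.of_forall hmax') (hd M))).symm
  set m' := m + 2 * Real.pi
  have hgm' : g m' < 0 := by rw [hper m]; exact hgm
  have hMm' : M ≤ m' := by linarith [hM.2, hm.1]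
  -- the first zero after the maximum
  have hK : IsCompact (Set.Icc M m' ∩ {u | g u = 0}) :=
    isCompact_Icc.inter_right (isClosed_eq hcont continuous_const)
  obtain ⟨u, ⟨hu, hgu⟩, hleast⟩ := hK.exists_isLeast (by
    obtain ⟨u, hu, hgu⟩ := intermediate_value_Icc' hMm' hcont.continuousOn
      (show (0 : ℝ) ∈ Set.Icc (g m') (g M) from ⟨hgm'.le, hgM.le⟩)
    exact ⟨u, hu, hgu⟩)
  have hgu : g u = 0 := hgu
  refine ⟨u, hgu, lt_of_le_of_ne ?_ (hns u hgu).symm⟩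
  by_contra hneg
  rw [not_le] at hneg
  have hMu : M < u := lt_of_le_of_ne hu.1 fun h => by rw [h, hgu] at hgM; exact lt_irrefl _ hgM
  -- If `⟨x, t⟩ < 0` at `u`, then `g` increases through 0 there, is negative just before, and so has
  -- an earlier zero after `M`.
  have hs := eventually_nhdsWithin_sign_eq_of_deriv_pos (f := g) (x₀ := u)
    (by rw [(hd u).deriv]; nlinarith [mul_pos (hpos u) (neg_pos.2 hneg)]) hgu
  obtain ⟨v, hv1, hv2⟩ := ((hs.filter_mono (nhdsWithin_le_nhds (s := Set.Iio u))).and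
    (Ioo_mem_nhdsLT hMu)).exists
  rw [sign_neg (sub_neg.2 hv2.2), sign_eq_neg_one_iff] at hv1
  obtain ⟨w, hw, hgw⟩ := intermediate_value_Icc' hv2.1.le hcont.continuousOn
    (show (0 : ℝ) ∈ Set.Icc (g v) (g M) from ⟨hv1.le, hgM.le⟩)
  have := hleast ⟨⟨hw.1, by linarith [hw.2, hv2.2, hu.2]⟩, hgw⟩
  linarith [hw.2, hv2.2]

lemma mem_image_tangentMap {x : E3} (hx : ‖x‖ < 1) (h1 : x ∉ cone Ω) (h2 : -x ∉ cone Ω)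
    (h3 : ∀ u, ∀ r : ℝ, x ≠ r • γ u) : x ∈ tangentMap γ '' tangentDomain := by
  obtain ⟨u, hn, ht⟩ := exists_inner_normal_eq_zero hγ hΩ hk h1 h2 h3
  obtain ⟨v, hv, n, rfl⟩ := exists_mem_Ico_eq u
  rw [hγ.periodic_normal.zsmul n v] at hn
  rw [hγ.periodic_tangent.zsmul n v] at ht
  have hexp := hγ.expansion v x
  rw [hn, zero_smul, add_zero] at hexp
  have hmap : tangentMap γ !₂[v, ⟪x, γ v⟫, ⟪x, tangent γ v⟫] = x := by
    rw [hexp]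
    simp [tangentMap, ← hexp]
  have hnorm := norm_tangentMap_sq hγ !₂[v, ⟪x, γ v⟫, ⟪x, tangent γ v⟫]
  rw [hmap] at hnorm
  refine ⟨!₂[v, ⟪x, γ v⟫, ⟪x, tangent γ v⟫], ⟨hv, ht, ?_⟩, hmap⟩
  rw [← hnorm]
  nlinarith [norm_nonneg x]

end

/-! ### Integration over the tangent half-disks -/

lemma lintegral_Ioo_ofReal {c : ℝ} (hc : 0 ≤ c) :
    ∫⁻ b in Set.Ioo 0 c, ENNReal.ofReal b = ENNReal.ofReal (c ^ 2 / 2) := by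
  rw [← ofReal_integral_eq_lintegral_ofReal, ← integral_Ioc_eq_integral_Ioo,
    ← intervalIntegral.integral_of_le hc, integral_id]
  · simp
  · exact (continuous_id.integrableOn_Icc).mono_set Set.Ioo_subset_Icc_self
  · exact (ae_restrict_iff' measurableSet_Ioo).2 (Filter.Eventually.of_forall fun b hb => hb.1.le)

/-- The open upper half of the unit disk. -/
def halfDisk : Set (ℝ × ℝ) := {q | 0 < q.2 ∧ q.1 ^ 2 + q.2 ^ 2 < 1}

lemma measurableSet_halfDisk : MeasurableSet halfDisk :=
  ((isOpen_lt continuous_const continuous_snd).inter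
    (isOpen_lt (by fun_prop : Continuous fun q : ℝ × ℝ => q.1 ^ 2 + q.2 ^ 2)
      continuous_const)).measurableSet

lemma lintegral_halfDisk : ∫⁻ q in halfDisk, ENNReal.ofReal q.2 = ENNReal.ofReal (2 / 3) := by
  have hm : Measurable fun q : ℝ × ℝ => ENNReal.ofReal q.2 := by fun_prop
  rw [← lintegral_indicator measurableSet_halfDisk, Measure.volume_eq_prod,
    lintegral_prod _ (hm.indicator measurableSet_halfDisk).aemeasurable]
  have h1 : ∀ a : ℝ, ∫⁻ b, halfDisk.indicator (fun q => ENNReal.ofReal q.2) (a, b) =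
      ENNReal.ofReal (√(1 - a ^ 2) ^ 2 / 2) := fun a => by
    rw [← lintegral_Ioo_ofReal (Real.sqrt_nonneg _), ← lintegral_indicator measurableSet_Ioo]
    congr 1
    ext b
    have : (a, b) ∈ halfDisk ↔ b ∈ Set.Ioo 0 √(1 - a ^ 2) := by
      refine and_congr_right fun hb => ?_
      have hb : 0 < b := hb
      rw [Real.lt_sqrt hb.le]
      exact (lt_sub_iff_add_lt'.symm)
    by_cases hb : b ∈ Set.Ioo 0 √(1 - a ^ 2)
    · rw [Set.indicator_of_mem hb, Set.indicator_of_mem (this.2 hb)]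
    · rw [Set.indicator_of_notMem hb, Set.indicator_of_notMem (this.not.2 hb)]
  simp only [h1]
  -- For `|a| > 1` the fibre is empty, matching the value 0 of `√` at negative numbers.
  have h2 : ∀ a : ℝ, ENNReal.ofReal (√(1 - a ^ 2) ^ 2 / 2) =
      (Set.Icc (-1 : ℝ) 1).indicator (fun a => ENNReal.ofReal ((1 - a ^ 2) / 2)) a := fun a => by
    by_cases ha : a ∈ Set.Icc (-1 : ℝ) 1
    · rw [Set.indicator_of_mem ha, Real.sq_sqrt]
      nlinarith [ha.1, ha.2]
    · rw [Set.indicator_of_notMem ha, Real.sqrt_eq_zero_of_nonpos]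
      · simp
      · by_contra h
        exact ha (abs_le.1 (by rw [← sq_le_one_iff_abs_le_one]; linarith))
  simp only [h2]
  rw [lintegral_indicator measurableSet_Icc, ← ofReal_integral_eq_lintegral_ofReal,
    integral_Icc_eq_integral_Ioc, ← intervalIntegral.integral_of_le (by norm_num)]
  · congr 1
    rw [intervalIntegral.integral_div, intervalIntegral.integral_sub (by simp) (by simp)]
    simp
    norm_num
  · exact Continuous.integrableOn_Icc (by fun_prop)
  · refine (ae_restrict_iff' measurableSet_Icc).2 (Filter.Eventually.of_forall fun a ha => ?_)
    have : 0 ≤ 1 - a ^ 2 := by nlinarith [ha.1, ha.2]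
    exact div_nonneg this zero_le_two

/-- The coordinates of Euclidean three-space as a triple of reals. -/
def toTriple (p : E3) : ℝ × ℝ × ℝ := (p 0, p 1, p 2)

lemma measurePreserving_toTriple : MeasurePreserving toTriple := by
  have h1 := PiLp.volume_preserving_ofLp (Fin 3)
  have h2 := volume_preserving_piFinSuccAbove (fun _ : Fin 3 => ℝ) 0
  have h3 := (MeasurePreserving.id (volume : Measure ℝ)).prod (volume_preserving_finTwoArrow ℝ)
  exact h3.comp (h2.comp h1)

lemma lintegral_tangentDomain {f : ℝ → ℝ} (hf : Continuous f) (hf0 : ∀ u, 0 ≤ f u) :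
    ∫⁻ p in tangentDomain, ENNReal.ofReal (p 2 * f (p 0)) =
      ENNReal.ofReal (2 / 3 * ∫ u in (0 : ℝ)..(2 * Real.pi), f u) := by
  have hset : tangentDomain = toTriple ⁻¹' (Set.Ico 0 (2 * Real.pi) ×ˢ halfDisk) := rfl
  have hm : Measurable fun q : ℝ × ℝ × ℝ => ENNReal.ofReal (f q.1) * ENNReal.ofReal q.2.2 := by
    have := hf.measurable
    fun_prop
  have e : ∀ p : E3, ENNReal.ofReal (p 2 * f (p 0)) =
      (fun q : ℝ × ℝ × ℝ => ENNReal.ofReal (f q.1) * ENNReal.ofReal q.2.2) (toTriple p) :=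
    fun p => by
      rw [mul_comm, ENNReal.ofReal_mul (hf0 _)]
      rfl
  simp only [e]
  rw [hset, measurePreserving_toTriple.setLIntegral_comp_preimage
    (measurableSet_Ico.prod measurableSet_halfDisk) hm, Measure.volume_eq_prod,
    ← Measure.prod_restrict,
    lintegral_prod_mul (f := fun u => ENNReal.ofReal (f u))
      (g := fun q : ℝ × ℝ => ENNReal.ofReal q.2)
      hf.measurable.ennreal_ofReal.aemeasurable
      (by fun_prop : Measurable fun q : ℝ × ℝ => ENNReal.ofReal q.2).aemeasurable,
    lintegral_halfDisk, ← ofReal_integral_eq_lintegral_ofReal, integral_Ico_eq_integral_Ioc,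
    ← intervalIntegral.integral_of_le Real.two_pi_pos.le, mul_comm,
    ENNReal.ofReal_mul (by norm_num)]
  · exact hf.integrableOn_Icc.mono_set Set.Ico_subset_Icc_self
  · exact Filter.Eventually.of_forall hf0

/-! ### The Gauss–Bonnet formula -/

open scoped Pointwise in
lemma smul_Ioo_eq_cone_inter_ball (Ω : Set S2) :
    Set.Ioo (0 : ℝ) 1 • (Subtype.val '' Ω : Set E3) = cone Ω ∩ Metric.ball 0 1 := by
  ext x
  rw [Set.mem_smul]
  constructor
  · rintro ⟨r, hr, _, ⟨y, hy, rfl⟩, rfl⟩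
    refine ⟨⟨y, hy, r, hr.1, rfl⟩, ?_⟩
    rw [mem_ball_zero_iff, norm_smul, norm_coe_S2, mul_one, Real.norm_of_nonneg hr.1.le]
    exact hr.2
  · rintro ⟨⟨y, hy, r, hr, rfl⟩, hb⟩
    rw [mem_ball_zero_iff, norm_smul, norm_coe_S2, mul_one, Real.norm_of_nonneg hr.le] at hb
    exact ⟨r, ⟨hr, hb⟩, y, ⟨y, hy, rfl⟩, rfl⟩

lemma area_eq {Ω : Set S2} (hΩ : IsOpen Ω) :
    area Ω = 3 * (volume (cone Ω ∩ Metric.ball 0 1)).toReal := by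
  rw [area, Measure.toSphere_apply' _ hΩ.measurableSet, smul_Ioo_eq_cone_inter_ball]
  simp

section

variable {γ : ℝ → E3} (hγ : IsSmoothSimpleClosed γ) {Ω : Set S2} (hΩ : IsEnclosedRegion γ Ω)
  (hk : ∀ u, 0 < geodesicCurvature γ u)
include hγ hΩ hk

lemma volume_image_tangentMap : volume (tangentMap γ '' tangentDomain) =
    ENNReal.ofReal (2 / 3 * arcIntegral γ (geodesicCurvature γ)) := by
  have hmeas : MeasurableSet tangentDomain := measurePreserving_toTriple.measurable
    (measurableSet_Ico.prod measurableSet_halfDisk)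
  rw [← lintegral_abs_det_fderiv_eq_addHaar_image volume hmeas
    (fun p _ => (hasFDerivAt_tangentMap hγ p).hasFDerivWithinAt) (injOn_tangentMap hγ hΩ hk),
    arcIntegral, ← lintegral_tangentDomain (f := fun u => geodesicCurvature γ u * speed γ u)
      (hγ.continuous_geodesicCurvature.mul hγ.continuous_speed)
      fun u => mul_nonneg (hk u).le (hγ.speed_pos u).le]
  refine setLIntegral_congr_fun hmeas fun p hp => ?_
  rw [det_tangentMapDeriv hγ, abs_of_nonneg]
  exact mul_nonneg hp.2.1.le (mul_nonneg (hk _).le (hγ.speed_pos _).le)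

/-- The Gauss–Bonnet formula for the region enclosed by a strictly convex curve. -/
theorem area_eq_two_pi_sub : area Ω = 2 * Real.pi - arcIntegral γ (geodesicCurvature γ) := by
  set B := Metric.ball (0 : E3) 1 with hB
  set C := cone Ω
  have hC : IsOpen C := isOpen_cone hΩ.isOpen
  have hCm : MeasurableSet (C ∩ B) := hC.measurableSet.inter Metric.isOpen_ball.measurableSet
  have hneg : Measurable fun x : E3 => -x := measurable_neg
  set I := tangentMap γ '' tangentDomain
  -- The lines through points of `γ` are not covered by the half-disks. They lie in `N`, which is
  -- null because frontiers of convex sets are null.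
  set N : Set E3 := frontier C ∪ (fun x => -x) ⁻¹' frontier C ∪ {0}
  have hN : volume N = 0 := by
    have h1 : volume (frontier C) = 0 := (convex_cone hγ hΩ hk).addHaar_frontier volume
    refine measure_union_null (measure_union_null h1 ?_) (measure_singleton 0)
    rw [Measure.measure_preimage_neg]
    exact h1
  have hI : ∀ x ∈ I, x ∈ B ∧ x ∉ C ∧ -x ∉ C := by
    rintro _ ⟨p, hp, rfl⟩
    refine ⟨?_, fun h => ?_, fun h => ?_⟩
    · rw [hB, mem_ball_zero_iff]
      have h1 := norm_tangentMap_sq hγ p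
      have h2 := hp.2.2
      rw [← h1] at h2
      exact (sq_lt_one_iff₀ (norm_nonneg _)).1 h2
    · have := inner_normal_pos_of_mem hγ hΩ hk h (p 0)
      rw [inner_tangentMap_normal] at this
      exact lt_irrefl _ this
    · have := inner_normal_pos_of_mem hγ hΩ hk h (p 0)
      rw [inner_neg_left, inner_tangentMap_normal, neg_zero] at this
      exact lt_irrefl _ this
  have hdisj1 : Disjoint (C ∩ B) ((fun x => -x) ⁻¹' (C ∩ B)) := by
    rw [Set.disjoint_left]
    rintro x ⟨hx, -⟩ ⟨hx', -⟩
    have h1 := inner_normal_pos_of_mem hγ hΩ hk hx 0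
    have h2 := inner_normal_pos_of_mem hγ hΩ hk hx' 0
    rw [inner_neg_left] at h2
    linarith
  have hdisj2 : Disjoint I (C ∩ B ∪ (fun x => -x) ⁻¹' (C ∩ B)) := by
    rw [Set.disjoint_left]
    rintro x hx (h | h)
    · exact (hI x hx).2.1 h.1
    · exact (hI x hx).2.2 h.1
  have hsum : volume B = volume I + (volume (C ∩ B) + volume (C ∩ B)) := by
    have h1 : volume (C ∩ B ∪ (fun x => -x) ⁻¹' (C ∩ B)) = volume (C ∩ B) + volume (C ∩ B) := by
      rw [measure_union hdisj1 (hneg hCm), Measure.measure_preimage_neg]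
    rw [← h1, ← measure_union hdisj2 (hCm.union (hneg hCm))]
    apply le_antisymm
    · have hsub : B ⊆ I ∪ (C ∩ B ∪ (fun x => -x) ⁻¹' (C ∩ B)) ∪ N := by
        intro x hxB
        by_cases hxN : x ∈ N
        · exact Or.inr hxN
        left
        by_cases hxC : x ∈ C
        · exact Or.inr (Or.inl ⟨hxC, hxB⟩)
        by_cases hxC' : -x ∈ C
        · refine Or.inr (Or.inr ⟨hxC', ?_⟩)
          rw [hB, mem_ball_zero_iff, norm_neg, ← mem_ball_zero_iff]
          exact hxB
        left
        refine mem_image_tangentMap hγ hΩ hk (mem_ball_zero_iff.1 hxB) hxC hxC' ?_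
        rintro u r rfl
        apply hxN
        rcases lt_trichotomy r 0 with hr | rfl | hr
        · refine Or.inl (Or.inr ⟨?_, by rwa [hC.interior_eq]⟩)
          change -(r • γ u) ∈ closure C
          rw [← neg_smul]
          exact smul_mem_closure_cone (mem_frontier_cone hγ hΩ u).1 (neg_pos.2 hr)
        · right
          simp
        · exact Or.inl (Or.inl ⟨smul_mem_closure_cone (mem_frontier_cone hγ hΩ u).1 hr,
            by rwa [hC.interior_eq]⟩)
      refine (measure_mono hsub).trans ((measure_union_le _ _).trans ?_)
      rw [hN, add_zero]
    · refine measure_mono ?_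
      rintro x (hx | hx | hx)
      · exact (hI x hx).1
      · exact hx.2
      · have h2 : -x ∈ B := hx.2
        rw [hB, mem_ball_zero_iff, norm_neg, ← mem_ball_zero_iff] at h2
        exact h2
  have hfin : volume (C ∩ B) ≠ ⊤ :=
    ((measure_mono Set.inter_subset_right).trans_lt measure_ball_lt_top).ne
  have hK : 0 ≤ arcIntegral γ (geodesicCurvature γ) :=
    intervalIntegral.integral_nonneg Real.two_pi_pos.le fun u _ =>
      mul_nonneg (hk u).le (hγ.speed_pos u).le
  -- In real numbers this reads `4π/3 = 2K/3 + 2 · A/3`.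
  have hreal := congrArg ENNReal.toReal hsum
  rw [volume_image_tangentMap hγ hΩ hk, EuclideanSpace.volume_ball_fin_three,
    ENNReal.toReal_add ENNReal.ofReal_ne_top (ENNReal.add_ne_top.2 ⟨hfin, hfin⟩),
    ENNReal.toReal_add hfin hfin, ENNReal.toReal_ofReal (by positivity)] at hreal
  simp only [ENNReal.ofReal_one, one_pow, one_mul] at hreal
  rw [ENNReal.toReal_ofReal (by positivity)] at hreal
  rw [area_eq hΩ.isOpen]
  linarith

end

end SphericalCurve

end

/-! ### The isoperimetric inequality and its equality case -/

theorem mainTheorem4 (γ : ℝ → SphericalCurve.E3) (Ω : Set SphericalCurve.S2)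
    (hγ : SphericalCurve.IsSmoothSimpleClosed γ)
    (hΩ : SphericalCurve.IsEnclosedRegion γ Ω)
    (hk : ∀ u, 0 < SphericalCurve.geodesicCurvature γ u)
    (L A : ℝ) (hL : L = SphericalCurve.length γ) (hA : A = SphericalCurve.area Ω)
    (k : ℝ → ℝ) (hkg : k = SphericalCurve.geodesicCurvature γ) :
    L ^ 2 - A * (4 * Real.pi - A) ≤
        (SphericalCurve.arcIntegral γ fun u => Real.sqrt (1 + k u ^ 2)) ^ 2 - 4 * Real.pi ^ 2
          - L / (1 + SphericalCurve.supCurvature γ ^ 2)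
            * (SphericalCurve.arcIntegral γ fun u => (k u - SphericalCurve.meanCurvature γ) ^ 2) ∧
      (L ^ 2 - A * (4 * Real.pi - A) =
        (SphericalCurve.arcIntegral γ fun u => Real.sqrt (1 + k u ^ 2)) ^ 2 - 4 * Real.pi ^ 2
          - L / (1 + SphericalCurve.supCurvature γ ^ 2)
            * (SphericalCurve.arcIntegral γ fun u => (k u - SphericalCurve.meanCurvature γ) ^ 2) ↔
        SphericalCurve.IsGeodesicCircle γ) := by
  have hkM : ∀ u, SphericalCurve.geodesicCurvature γ u ≤ SphericalCurve.supCurvature γ := by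
    -- Boundedness is needed because an unbounded real supremum takes the default value 0;
    -- periodicity reduces it to a compact interval.
    have hbdd : BddAbove (Set.range fun u => |SphericalCurve.geodesicCurvature γ u|) := by
      obtain ⟨b, hb⟩ := (isCompact_Icc (a := (0 : ℝ)) (b := 2 * Real.pi)).bddAbove_image
        hγ.continuous_geodesicCurvature.abs.continuousOn
      refine ⟨b, ?_⟩
      rintro _ ⟨u, rfl⟩
      obtain ⟨v, hv, n, rfl⟩ := SphericalCurve.exists_mem_Ico_eq u
      refine hb ⟨v, Set.Ico_subset_Icc_self hv, ?_⟩
      simp only [hγ.periodic_geodesicCurvature.zsmul n v]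
    exact fun u => (le_abs_self _).trans (le_ciSup hbdd u)
  have hGB := SphericalCurve.area_eq_two_pi_sub hγ hΩ hk
  have hL' : L = ∫ u in (0 : ℝ)..(2 * Real.pi), SphericalCurve.speed γ u := by
    rw [hL, SphericalCurve.length, SphericalCurve.arcIntegral]
    simp only [one_mul]
  have hLpos : 0 < L := by
    rw [hL']
    exact intervalIntegral.intervalIntegral_pos_of_pos
      (hγ.continuous_speed.intervalIntegrable _ _) hγ.speed_pos Real.two_pi_pos
  have hid := SphericalCurve.integral_integral_deficit (a := 0) (b := 2 * Real.pi)
    (M := SphericalCurve.supCurvature γ) hγ.continuous_speed hγ.continuous_geodesicCurvature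
    (hL' ▸ hLpos.ne')
  have hnn := SphericalCurve.integral_integral_deficit_nonneg Real.two_pi_pos hγ.speed_pos hk hkM
  have hiff := SphericalCurve.integral_integral_deficit_eq_zero_iff Real.two_pi_pos
    hγ.continuous_speed hγ.continuous_geodesicCurvature hγ.speed_pos hk hkM
  have hcirc : SphericalCurve.IsGeodesicCircle γ ↔ ∀ u ∈ Set.Icc 0 (2 * Real.pi),
      ∀ v ∈ Set.Icc 0 (2 * Real.pi),
        SphericalCurve.geodesicCurvature γ u = SphericalCurve.geodesicCurvature γ v := by
    refine ⟨fun h u _ v _ => hγ.geodesicCurvature_const_of_isGeodesicCircle hk h u v, fun h => ?_⟩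
    refine hγ.isGeodesicCircle_of_geodesicCurvature_const
      (κ := SphericalCurve.geodesicCurvature γ 0) fun u => ?_
    obtain ⟨v, hv, n, rfl⟩ := SphericalCurve.exists_mem_Ico_eq u
    rw [hγ.periodic_geodesicCurvature.zsmul n v]
    exact h v (Set.Ico_subset_Icc_self hv) 0 ⟨le_rfl, Real.two_pi_pos.le⟩
  rw [hid, ← hL'] at hnn hiff
  rw [hcirc, ← hiff, hA, hGB, hkg]
  simp only [SphericalCurve.arcIntegral, SphericalCurve.meanCurvature, ← hL]
  set K := ∫ u in (0 : ℝ)..(2 * Real.pi),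
    SphericalCurve.geodesicCurvature γ u * SphericalCurve.speed γ u
  -- With Gauss–Bonnet inserted, the right side of the claim minus the left is exactly the double
  -- integral of `deficit`.
  have e : L ^ 2 - (2 * Real.pi - K) * (4 * Real.pi - (2 * Real.pi - K)) =
      L ^ 2 + K ^ 2 - 4 * Real.pi ^ 2 := by ring
  rw [e]
  refine ⟨by linarith, fun h => by linarith, fun h => by linarith⟩
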